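/- **Setting.** Let $G=(V,E)$ be any digraph without loops (possibly infinite) and $R$ a commutative ring. $\mathcal A_n(G;R)$ is the free $R$-module on the allowed $n$-paths $e_{v_0,\dots,v_n}$ ($(v_{i-1},v_i)\in E$ for all $i$), regarded inside the module of elementary $n$-paths modulo irregular ones (those with $v_{i-1}=v_i$ for some $i$); $\partial=\sum_i(-1)^i\partial_i$ is the alternating sum of vertex deletions ($\partial=0$ on $0$-paths), and $$\Omega_n(G;R)=\{x\in\mathcal A_n(G;R): \partial x\in\mathcal A_{n-1}(G;R)\},\qquad \Omega_n=0 \text{ for } n<0 .$$ $\Omega_n^{a,b}(G;R)$ is the submodule of chains all of whose paths go from $a$ (tail) to $b$ (head). A basis of $\Omega_n(G;R)$ *respects the bigrading* if it restricts to a basis of every $\Omega_n^{a,b}(G;R)$. The head set $\bar h(x)$ is the set of last vertices of the paths with nonzero coefficient in $x$; $x$ is *upper connected* with head $h(x)$ if $\bar h(x)=\{h(x)\}$. Let $\delta^h_{n,u}$ keep the paths with $v_{n-1}=u$ and delete their last vertex ($\delta^h_{0,u}=0$), and let $[x]^v$ be obtained by appending $v$ to each path of $x$, dropping the results that are not allowed.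 The *lower* notions are obtained by exchanging the roles of first and last vertices. **Face multihypergraphs.** Let $x_1,\dots,x_m\in\Omega_n(G;R)$ (repetitions allowed) with $x_i\ne -x_j$ for $i\neq j$. For every $i$ and $u$ with $\delta^h_{n,u}(x_i)\ne0$ fix a decomposition $\delta^h_{n,u}(x_i)=x_i^{u,1}+\dots+x_i^{u,m_i^u}$ in $\Omega_{n-1}(G;R)$ no nonempty subsequence of which sums to $0$. An upper face multihypergraph on this data has vertices $1,\dots,m$ (labeled by $x_1,\dots,x_m$) and hyperedges of two kinds: edges labeled $(\{x_i^{u,k},x_j^{u,l}\},u)$ with $i\ne j$ and $x_i^{u,k}=-x_j^{u,l}$, and, for $t\ge3$, hyperedges labeled $(\{x_{i_1}^{u,k_1},\dots,x_{i_t}^{u,k_t}\},u)$, with $t$ distinct pairs $(i_j,k_j)$ and the vertices $i_1,\dots,i_t$ not all equal, such that $x_{i_1}^{u,k_1}=\dots=x_{i_t}^{u,k_t}$ and $\sum_j x_{i_j}^{u,k_j}=0$. Each summand $x_i^{u,k}$ (indexed by $(i,u,k)$) occurs in at most one hyperedge label. A *mutation* passes to another face multihypergraph on the same data by one of the following operations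 at a vertex $u$: (1) replacing two edges $\{a,b\},\{a',b'\}$ by $\{a,b'\},\{b,a'\}$ or by $\{a,a'\},\{b,b'\}$; (2) replacing two hyperedges $\{a_1,\dots,a_t\},\{b_1,\dots,b_t\}$, $t\geq3$, by the edges $\{a_j,b_j\}$, $j=1,\dots,t$, or the reverse; (3) replacing two hyperedges of size $t\ge3$ by two hyperedges of size $t$ on the same $2t$ summands. A face multihypergraph is *strongly connected* if every face multihypergraph obtained from it by a (possibly empty) sequence of mutations is connected. It is extended by $v\in V$ if $(w,v)\in E$ for all $i$ and all $w\in\bar h(x_i)$; the extension is $[x_1+\dots+x_m]^v$. It is *$v$-complete* if all its hyperedges belong to vertices $u\neq v$ with $(u,v)\notin E$, and, conversely, for every such $u$ each summand $x_i^{u,k}$ occurs in a hyperedge label. **Inductive elements.** For $n\ge1$, $B\subseteq\Omega_{n-1}(G;R)$ and $B'\subseteq\Omega_{n-2}(G;R)$, an upper connected $x\in\Omega_n(G;R)$ is *upper $(B,B')$-inductive* if it is the extension by $h(x)$ over some strongly connected, $h(x)$-complete upper face multihypergraph on some $x_1,\dots,x_m\in\Omega_{n-1}(G;R)$ such that all $x_i$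 lie in $B$ up to sign and all $x_i^{u,k}$ lie in $B'$ up to sign. Lower $(B,B')$-inductive elements are defined in the same way from the lower notions. **Theorem.** Let $n\ge1$, let $R=\mathbb Z$ or $R=\mathbb Z_p=\mathbb Z/p$ for a prime $p$, and let $B_{n-1}$, $B_{n-2}$ be $R$-bases of $\Omega_{n-1}(G;R)$ and $\Omega_{n-2}(G;R)$ which respect the bigradings. Then the upper $(B_{n-1},B_{n-2})$-inductive elements generate $\Omega_n(G;R)$, and so do the lower ones. Moreover, for the upper and for the lower inductive elements alike: 1. if $R=\mathbb Z_p$, some subset of the $(B_{n-1},B_{n-2})$-inductive elements is a $\mathbb Z_p$-basis of $\Omega_n(G;\mathbb Z_p)$; 2. if $R=\mathbb Z$ and $K$ is a field of characteristic $0$, some subset of the image of the $(B_{n-1},B_{n-2})$-inductive elements under $\Omega_n(G;\mathbb Z)\to\Omega_n(G;\mathbb Z)\otimes K\xrightarrow{\mu_n}\Omega_n(G;K)$, where $\mu_n(x\otimes k)=kx$, is a $K$-basis of $\Omega_n(G;K)$. -/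

import Mathlib

open scoped TensorProduct

noncomputable section

namespace PathHomology

/-- Finite formal `R`-linear combinations of finite vertex sequences. The elementary path
`e_{v_0,…,v_n}` is `Finsupp.single [v_0,…,v_n] 1`. -/
abbrev Chain (V R : Type*) [CommRing R] := List V →₀ R

section Omega

variable {V : Type*}

/-- The vertex sequences `v_0,…,v_n`; there are none when `n < 0`. -/
def IsElementary (n : ℤ) (l : List V) : Prop :=
  l ≠ [] ∧ (l.length : ℤ) = n + 1

/-- Allowed `n`-paths of `G`: all consecutive pairs are edges. -/
def IsAllowed (G : Digraph V) (n : ℤ) (l : List V) : Prop :=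
  IsElementary n l ∧ l.IsChain G.Adj

/-- Irregular elementary `n`-paths: two consecutive vertices coincide. -/
def IsIrregular (n : ℤ) (l : List V) : Prop :=
  IsElementary n l ∧ ¬ l.IsChain (fun a b => a ≠ b)

/-- The module spanned by the allowed `n`-paths. -/
def allowed (G : Digraph V) (R : Type*) [CommRing R] (n : ℤ) : Submodule R (Chain V R) :=
  Finsupp.supported R R {l | IsAllowed G n l}

/-- The module spanned by the irregular elementary `n`-paths. -/
def irregular (V R : Type*) [CommRing R] (n : ℤ) : Submodule R (Chain V R) :=
  Finsupp.supported R R {l : List V | IsIrregular n l}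

/-- The path differential on an elementary path: the alternating sum of all faces. The
differential of a `0`-path vanishes. -/
def boundaryPath (R : Type*) [CommRing R] (l : List V) : Chain V R :=
  if l.length ≤ 1 then 0
  else ∑ i ∈ Finset.range l.length, Finsupp.single (l.eraseIdx i) ((-1 : R) ^ i)

/-- The path differential `∂^P`. -/
def boundary (V R : Type*) [CommRing R] : Chain V R →ₗ[R] Chain V R :=
  Finsupp.linearCombination R (boundaryPath R)

/-- The path chains `Ω_n(G;R)`: allowed chains whose differential is allowed modulo irregular
paths (that is, allowed in the module of regular paths). -/
def Omega (G : Digraph V) (R : Type*) [CommRing R] (n : ℤ) : Submodule R (Chain V R) :=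
  allowed G R n ⊓ (allowed G R (n - 1) ⊔ irregular V R (n - 1)).comap (boundary V R)

/-- The bigraded piece `Ω_n^{a,b}(G;R)` of chains all of whose paths go from `a` to `b`. -/
def OmegaBi (G : Digraph V) (R : Type*) [CommRing R] (n : ℤ) (a b : V) :
    Submodule R (Chain V R) :=
  Omega G R n ⊓ Finsupp.supported R R {l | l.head? = some a ∧ l.getLast? = some b}

end Omega

section Basis

variable {V R : Type*} [CommRing R]

/-- The set `B` is an `R`-basis of the submodule `M`. -/
def IsBasisOf {N : Type*} [AddCommGroup N] [Module R N] (B : Set N) (M : Submodule R N) : Prop :=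
  LinearIndependent R (Subtype.val : B → N) ∧ Submodule.span R B = M

/-- `B` is an `R`-basis of `Ω_n(G;R)` which restricts to a basis of every bigraded piece. -/
def IsBigradedBasis (G : Digraph V) (n : ℤ) (B : Set (Chain V R)) : Prop :=
  IsBasisOf B (Omega G R n) ∧
    ∀ a b : V, IsBasisOf (B ∩ (OmegaBi G R n a b : Set (Chain V R))) (OmegaBi G R n a b)

end Basis

/-- Upper notions work at the last vertex (the head) of a path, lower ones at the first vertex
(the tail). -/
inductive Side : Type
  | upper : Side
  | lower : Side

section Extensions

variable {V R : Type*} [CommRing R]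

/-- `(u,v)` is an edge (upper case), respectively `(v,u)` is an edge (lower case). -/
def Side.Adj (s : Side) (G : Digraph V) (u v : V) : Prop :=
  match s with
  | .upper => G.Adj u v
  | .lower => G.Adj v u

/-- The last (upper), respectively first (lower), vertex of a path. -/
def Side.endpoint (s : Side) (l : List V) : Option V :=
  match s with
  | .upper => l.getLast?
  | .lower => l.head?

/-- The path with its last (upper), respectively first (lower), vertex removed. -/
def Side.face (s : Side) (l : List V) : List V :=
  match s with
  | .upper => l.dropLast
  | .lower => l.tail

/-- The path with `v` added after its last (upper), respectively before its first (lower),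
vertex. -/
def Side.add (s : Side) (v : V) (l : List V) : List V :=
  match s with
  | .upper => l ++ [v]
  | .lower => v :: l

/-- The head set (upper), respectively tail set (lower), of a chain. -/
def Side.ends (s : Side) (x : Chain V R) : Set V :=
  {v | ∃ l ∈ x.support, s.endpoint l = some v}

open Classical in
/-- The map `δ^h_{n,u}` (upper), respectively `δ^t_{n,u}` (lower): keep the paths whose
next-to-last (second) vertex is `u`, and remove their last (first) vertex. -/
def Side.delta (s : Side) (u : V) : Chain V R →ₗ[R] Chain V R :=
  Finsupp.linearCombination R fun l =>
    if s.endpoint (s.face l) = some u then Finsupp.single (s.face l) 1 else 0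

open Classical in
/-- The upper extension `[x]^v`, respectively lower extension `[x]_v`. -/
def Side.extend (s : Side) (G : Digraph V) (v : V) : Chain V R →ₗ[R] Chain V R :=
  Finsupp.linearCombination R fun l =>
    if (s.add v l).IsChain G.Adj then Finsupp.single (s.add v l) 1 else 0

end Extensions

/-- The vertices `x_1,…,x_m ∈ Ω_n(G;R)` of a face multihypergraph (repetitions are possible),
with decompositions `δ_{n,u}(x_i) = x_i^{u,1} + ⋯ + x_i^{u,c i u}` in `Ω_{n-1}(G;R)` no nonempty
subsequence of which sums to zero. In particular `c i u = 0` exactly when `δ_{n,u}(x_i) = 0`. -/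
structure FaceData {V : Type*} (G : Digraph V) (R : Type*) [CommRing R] (s : Side) (n : ℤ) where
  m : ℕ
  x : Fin m → Chain V R
  x_mem : ∀ i, x i ∈ Omega G R n
  x_ne_neg : ∀ i j, i ≠ j → x i ≠ - x j
  c : Fin m → V → ℕ
  part : ∀ (i : Fin m) (u : V), Fin (c i u) → Chain V R
  part_mem : ∀ i u k, part i u k ∈ Omega G R (n - 1)
  delta_eq : ∀ i u, s.delta u (x i) = ∑ k, part i u k
  part_sum_ne_zero : ∀ i u (t : Finset (Fin (c i u))), t.Nonempty → ∑ k ∈ t, part i u k ≠ 0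

namespace FaceData

variable {V : Type*} {G : Digraph V} {R : Type*} [CommRing R] {s : Side} {n : ℤ}

/-- The indices `(i,k)` of the summands `x_i^{u,k}` at `u`. -/
abbrev Slot (D : FaceData G R s n) (u : V) : Type := Σ i : Fin D.m, Fin (D.c i u)

/-- The summand `x_i^{u,k}`. -/
def val (D : FaceData G R s n) {u : V} (a : D.Slot u) : Chain V R := D.part a.1 u a.2

/-- A hyperedge label `({x_{i_1}^{u,k_1},…,x_{i_t}^{u,k_t}},u)`. It determines the hyperedge: the
vertices joined are `i_1,…,i_t`. -/
abbrev Label (D : FaceData G R s n) : Type _ := Σ u : V, Finset (D.Slot u)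

/-- Labels of edges: two summands of opposite value at distinct vertices. -/
def IsEdge (D : FaceData G R s n) {u : V} (e : Finset (D.Slot u)) : Prop :=
  ∃ a b : D.Slot u, a.1 ≠ b.1 ∧ D.val a = - D.val b ∧ e = {a, b}

/-- Labels of larger hyperedges: at least three summands, not all at the same vertex, which are
all equal and sum to zero. -/
def IsBigEdge (D : FaceData G R s n) {u : V} (e : Finset (D.Slot u)) : Prop :=
  3 ≤ e.card ∧ (∃ a ∈ e, ∃ b ∈ e, a.1 ≠ b.1) ∧
    (∀ a ∈ e, ∀ b ∈ e, D.val a = D.val b) ∧ ∑ a ∈ e, D.val a = 0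

/-- The hyperedges with labels in `E` form a face multihypergraph on the given data: each of them
is an edge or a larger hyperedge, and no summand is used by two of them. -/
def IsFaceMultihypergraph (D : FaceData G R s n) (E : Set D.Label) : Prop :=
  (∀ e ∈ E, D.IsEdge e.2 ∨ D.IsBigEdge e.2) ∧
    ∀ (u : V) (e f : Finset (D.Slot u)), (⟨u, e⟩ : D.Label) ∈ E → (⟨u, f⟩ : D.Label) ∈ E →
      e ≠ f → Disjoint e f

/-- Vertices `i` and `j` lie in a common hyperedge. -/
def Joined (D : FaceData G R s n) (E : Set D.Label) (i j : Fin D.m) : Prop :=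
  ∃ e ∈ E, (∃ a ∈ e.2, a.1 = i) ∧ ∃ b ∈ e.2, b.1 = j

/-- Connectedness of the underlying multihypergraph. -/
def Connected (D : FaceData G R s n) (E : Set D.Label) : Prop :=
  ∀ i j, Relation.ReflTransGen (D.Joined E) i j

/-- Two edges `{a,b}`, `{a',b'}` at `u` are replaced by `{a,b'}`, `{b,a'}`. (Exchanging the names of
`a'` and `b'` gives the other possible replacement.) -/
def EdgeMutation (D : FaceData G R s n) (E E' : Set D.Label) : Prop :=
  ∃ (u : V) (a b a' b' : D.Slot u),
    ({a, b} : Finset (D.Slot u)) ≠ {a', b'} ∧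
    (⟨u, {a, b}⟩ : D.Label) ∈ E ∧ (⟨u, {a', b'}⟩ : D.Label) ∈ E ∧
    E' = (E \ {⟨u, {a, b}⟩, ⟨u, {a', b'}⟩}) ∪ {⟨u, {a, b'}⟩, ⟨u, {b, a'}⟩}

/-- Two hyperedges of the same size `t ≥ 3` at `u` are replaced by `t` edges which match the
summands of one with those of the other. -/
def SplitMutation (D : FaceData G R s n) (E E' : Set D.Label) : Prop :=
  ∃ (u : V) (e f : Finset (D.Slot u)) (σ : e ≃ f),
    e ≠ f ∧ 3 ≤ e.card ∧ (⟨u, e⟩ : D.Label) ∈ E ∧ (⟨u, f⟩ : D.Label) ∈ E ∧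
    E' = (E \ {⟨u, e⟩, ⟨u, f⟩}) ∪
      Set.range (fun a : e => (⟨u, {(a : D.Slot u), (σ a : D.Slot u)}⟩ : D.Label))

/-- Two hyperedges of the same size `t ≥ 3` at `u` are replaced by two hyperedges of size `t` on
the same `2t` summands. -/
def ShuffleMutation (D : FaceData G R s n) (E E' : Set D.Label) : Prop :=
  ∃ (u : V) (e f e' f' : Finset (D.Slot u)),
    e ≠ f ∧ 3 ≤ e.card ∧ e.card = f.card ∧ (⟨u, e⟩ : D.Label) ∈ E ∧ (⟨u, f⟩ : D.Label) ∈ E ∧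
    e'.card = e.card ∧ f'.card = e.card ∧ Disjoint e' f' ∧ e' ∪ f' = e ∪ f ∧
    E' = (E \ {⟨u, e⟩, ⟨u, f⟩}) ∪ {⟨u, e'⟩, ⟨u, f'⟩}

/-- One face multihypergraph is a mutation of another one on the same data. -/
def Mutation (D : FaceData G R s n) (E E' : Set D.Label) : Prop :=
  D.IsFaceMultihypergraph E ∧ D.IsFaceMultihypergraph E' ∧
    (D.EdgeMutation E E' ∨ D.SplitMutation E E' ∨ D.SplitMutation E' E ∨ D.ShuffleMutation E E')

/-- All face multihypergraphs mutation equivalent to `E` (including `E`) are connected. -/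
def StronglyConnected (D : FaceData G R s n) (E : Set D.Label) : Prop :=
  ∀ E', Relation.EqvGen D.Mutation E E' → D.Connected E'

/-- `y` is the extension of `x_1 + ⋯ + x_m` by `v`, and every head (tail) of every `x_i` is joined
to `v` by an edge in the required direction. -/
def IsExtension (D : FaceData G R s n) (v : V) (y : Chain V R) : Prop :=
  (∀ i, ∀ w ∈ s.ends (D.x i), s.Adj G w v) ∧ y = s.extend G v (∑ i, D.x i)

/-- All hyperedges lie at vertices `u ≠ v` with no edge between `u` and `v` in the relevant
direction. -/
def Proper (D : FaceData G R s n) (E : Set D.Label) (v : V) : Prop :=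
  ∀ e ∈ E, ¬ s.Adj G e.1 v ∧ e.1 ≠ v

/-- `v`-completeness: properness, and every summand `x_i^{u,k}` at a vertex `u ≠ v` without an edge
to (from) `v` is used by a hyperedge. -/
def Complete (D : FaceData G R s n) (E : Set D.Label) (v : V) : Prop :=
  D.Proper E v ∧
    ∀ u, u ≠ v → ¬ s.Adj G u v → ∀ a : D.Slot u, ∃ e, (⟨u, e⟩ : D.Label) ∈ E ∧ a ∈ e

end FaceData

/-- The upper (lower) `(B,B')`-inductive elements of `Ω_n(G;R)`, for `B ⊆ Ω_{n-1}(G;R)` and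
`B' ⊆ Ω_{n-2}(G;R)`. The condition `s.ends y = {v}` says that `y` is upper (lower) connected with
head (tail) `v`. -/
def inductiveElements {V R : Type*} [CommRing R] (G : Digraph V) (s : Side) (n : ℤ)
    (B B' : Set (Chain V R)) : Set (Chain V R) :=
  {y | y ∈ Omega G R n ∧ ∃ v : V, s.ends y = {v} ∧
    ∃ (D : FaceData G R s (n - 1)) (E : Set D.Label),
      D.IsFaceMultihypergraph E ∧ D.StronglyConnected E ∧
      D.IsExtension v y ∧ D.Complete E v ∧
      (∀ i, D.x i ∈ B ∨ - D.x i ∈ B) ∧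
      (∀ i u k, D.part i u k ∈ B' ∨ - D.part i u k ∈ B')}

section CoefficientChange

variable {V : Type*} (K : Type*) [Field K]

/-- The map on chains which sends integer coefficients to their images in `K`. -/
def castChain (V : Type*) : Chain V ℤ →ₗ[ℤ] Chain V K :=
  Finsupp.mapRange.linearMap (Algebra.linearMap ℤ K)

theorem castChain_single (l : List V) (a : ℤ) :
    castChain K V (Finsupp.single l a) = Finsupp.single l (a : K) := by
  simp [castChain]

theorem castChain_supported {S : Set (List V)} {x : Chain V ℤ}
    (hx : x ∈ Finsupp.supported ℤ ℤ S) : castChain K V x ∈ Finsupp.supported K K S := by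
  rw [Finsupp.mem_supported'] at hx ⊢
  intro l hl
  simp [castChain, hx l hl]

theorem castChain_boundary (x : Chain V ℤ) :
    castChain K V (boundary V ℤ x) = boundary V K (castChain K V x) := by
  induction x using Finsupp.induction_linear with
  | zero => simp
  | add f g hf hg => simp [hf, hg]
  | single l a =>
    rw [castChain_single]
    simp only [boundary, Finsupp.linearCombination_single, map_smul, boundaryPath]
    split_ifs
    · simp
    · simp [map_sum, castChain_single, Finset.smul_sum]

theorem castChain_mem_Omega (G : Digraph V) (n : ℤ) {x : Chain V ℤ} (hx : x ∈ Omega G ℤ n) :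
    castChain K V x ∈ Omega G K n := by
  refine ⟨castChain_supported K hx.1, ?_⟩
  have h := hx.2
  simp only [Submodule.comap_coe, Set.mem_preimage, SetLike.mem_coe] at h ⊢
  obtain ⟨y, hy, z, hz, hyz⟩ := Submodule.mem_sup.1 h
  rw [← castChain_boundary, ← hyz, map_add]
  exact Submodule.add_mem_sup (castChain_supported K hy) (castChain_supported K hz)

/-- The map `μ_n : K ⊗ Ω_n(G;ℤ) → Ω_n(G;K)`, `k ⊗ x ↦ k x`. -/
def mu (G : Digraph V) (n : ℤ) : K ⊗[ℤ] Omega G ℤ n →ₗ[K] Omega G K n :=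
  LinearMap.liftBaseChange K
    { toFun := fun x => ⟨castChain K V x.1, castChain_mem_Omega K G n x.2⟩
      map_add' := fun x y => Subtype.ext (by simp)
      map_smul' := fun k x => Subtype.ext (by simp) }

end CoefficientChange

end PathHomology

end

open PathHomology

/-! Let (a,b) be a non-edge with a ≠ b. A word p,a,b,q arises from allowed paths only by deleting
the vertex u of p,a,u,b,q, always with the same sign. So Ω_n is cut out of the allowed chains by
linear equations, each involving only paths that differ in one interior vertex (`mem_Omega_iff`).
These equations survive restriction to paths with prescribed ends, so it suffices to treat chains
with a single head v (or tail, for the lower notions). Such a chain is an extension of some y in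
Ω_{n-1}. The equations at gaps away from v say that y lies in Ω_{n-1}, and those at gaps next to v
say that δ_u y = 0 for every u ≠ v not joined to v (`Side.mapDomain_add_mem_Omega`).

Expand y in those basis elements that v extends, replacing a coefficient by repeated copies of ± a
basis element so that no partial sum vanishes; this is possible over ℤ and ℤ/p. Expand all faces
likewise. At each u not joined to v the face summands total zero, hence fall into opposite pairs and
blocks of at least three equal terms: these are the hyperedges of a v-complete face multihypergraph
(`FaceData.exists_complete`). If it is strongly connected, the extension of y is inductive.
Otherwise some sequence of mutations disconnects it. Mutations keep the set of used summands, so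
completeness persists and the faces cancel within each component. Thus y splits into two shorter
sums of the same kind, and induction on the number of terms finishes (`extend_sum_mem_span`).

Over a field every generating set contains a basis. In characteristic 0 the equations for Ω_n have
integer coefficients, so integral solutions span all solutions (`mem_span_castChain`). -/

noncomputable section

namespace PathHomology

/-! ### Linear equations cutting out Ω_n -/

section Gap

variable {V : Type*}

/-- Deleting a vertex of an allowed path produces the non-edge `(a,b)` at a given place only if the
deleted vertex was between `a` and `b`. -/
theorem eraseIdx_eq_append_iff {r : V → V → Prop} {l p q : List V} {a b : V}
    (hl : l.IsChain r) (hab : ¬ r a b) {i : ℕ} (hi : i < l.length) :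
    l.eraseIdx i = p ++ a :: b :: q ↔ i = p.length + 1 ∧ ∃ u, l = p ++ a :: u :: b :: q := by
  constructor
  · intro h
    rw [List.eraseIdx_eq_take_drop_succ] at h
    have hsplit : l = l.take i ++ l[i] :: l.drop (i + 1) := by simp
    have hlen : (l.take i).length = i := by simp [hi.le]
    generalize l.take i = s at *
    generalize l.drop (i + 1) = t at *
    generalize l[i] = c at *
    subst hsplit hlen
    rw [List.isChain_iff_forall_rel_of_append_cons_cons] at hl
    rcases List.append_eq_append_iff.1 h with ⟨z, rfl, rfl⟩ | ⟨z, rfl, hz⟩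
    · exact absurd (hl (a := a) (b := b) (l₁ := s ++ c :: z) (l₂ := q) (by simp)) hab
    · match z, hz with
      | [], hz =>
        exact absurd (hl (a := a) (b := b) (l₁ := p ++ [c]) (l₂ := q) (by simp_all)) hab
      | [x], hz =>
        simp only [List.cons_append, List.nil_append, List.cons.injEq] at hz
        simp [hz.1, hz.2]
      | x :: y :: z, hz =>
        simp only [List.cons_append, List.cons.injEq] at hz
        exact absurd (hl (a := a) (b := b) (l₁ := p) (l₂ := z ++ c :: t) (by simp [hz])) hab
  · rintro ⟨rfl, u, rfl⟩
    rw [List.eraseIdx_append_of_length_le (by omega)]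
    simp

variable {R : Type*} [CommRing R]

open Classical in
/-- The sum over `u` of the coefficients of the paths `p, a, u, b, q`. -/
def gapSum (R : Type*) [CommRing R] (p : List V) (a b : V) (q : List V) : Chain V R →ₗ[R] R :=
  Finsupp.linearCombination R fun l => if ∃ u, l = p ++ a :: u :: b :: q then 1 else 0

theorem gapSum_single_of (p : List V) (a b : V) (q : List V) {l : List V} (c : R)
    (h : ∃ u, l = p ++ a :: u :: b :: q) : gapSum R p a b q (Finsupp.single l c) = c := by
  simp [gapSum, h]

theorem gapSum_single_of_not (p : List V) (a b : V) (q : List V) {l : List V} (c : R)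
    (h : ¬ ∃ u, l = p ++ a :: u :: b :: q) : gapSum R p a b q (Finsupp.single l c) = 0 := by
  simp [gapSum, h]

theorem gapSum_eq_zero (p : List V) (a b : V) (q : List V) {x : Chain V R}
    (h : ∀ u, x (p ++ a :: u :: b :: q) = 0) : gapSum R p a b q x = 0 := by
  rw [gapSum, Finsupp.linearCombination_apply]
  refine Finset.sum_eq_zero fun l _ => ?_
  dsimp only
  split_ifs with hl
  · obtain ⟨u, rfl⟩ := hl
    simp [h]
  · simp

/-- The target word contains the non-edge (a,b), so only deletion at position `p.length + 1` can
produce it; all contributions therefore carry one common sign. -/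
theorem boundary_apply_eq_gapSum {G : Digraph V} {n : ℤ} {x : Chain V R}
    (hx : x ∈ allowed G R n) (p : List V) {a b : V} (q : List V) (hab : ¬ G.Adj a b) :
    boundary V R x (p ++ a :: b :: q) = (-1) ^ (p.length + 1) * gapSum R p a b q x := by
  have h1 : boundary V R x (p ++ a :: b :: q) =
      x.sum fun l c => c * boundaryPath R l (p ++ a :: b :: q) := by
    simp [boundary, Finsupp.linearCombination_apply, Finsupp.sum]
  rw [h1, gapSum, Finsupp.linearCombination_apply, Finsupp.mul_sum]
  refine Finset.sum_congr rfl fun l hl => ?_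
  have hall : IsAllowed G n l := hx hl
  classical
  have h2 : boundaryPath R l (p ++ a :: b :: q) =
      ∑ i ∈ Finset.range l.length, if i = p.length + 1 ∧ ∃ u, l = p ++ a :: u :: b :: q
        then (-1 : R) ^ i else 0 := by
    rw [boundaryPath]
    split_ifs with hlen
    · symm
      refine Finset.sum_eq_zero fun i _ => if_neg ?_
      rintro ⟨-, u, rfl⟩
      simp only [List.length_append, List.length_cons] at hlen
      omega
    · rw [Finsupp.finsetSum_apply]
      refine Finset.sum_congr rfl fun i hi => ?_
      rw [Finsupp.single_apply]
      exact if_congr (eraseIdx_eq_append_iff hall.2 hab (Finset.mem_range.1 hi)) rfl rfl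
  dsimp only
  rw [h2]
  by_cases hu : ∃ u, l = p ++ a :: u :: b :: q
  · have : p.length + 1 ∈ Finset.range l.length := by
      obtain ⟨u, rfl⟩ := hu
      simp
    simp only [hu, and_true, Finset.sum_ite_eq', this, if_true]
    simp [mul_comm]
  · simp [hu]

/-- `Ω_n` is cut out of the allowed chains by the vanishing of all sums over the paths that run
from `a` to `b` through one intermediate vertex, where `(a,b)` is not an edge and `a ≠ b`. -/
theorem mem_Omega_iff {G : Digraph V} (hG : ∀ v, ¬ G.Adj v v) {n : ℤ} {x : Chain V R} :
    x ∈ Omega G R n ↔ x ∈ allowed G R n ∧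
      ∀ p a b q, a ≠ b → ¬ G.Adj a b → gapSum R p a b q x = 0 := by
  rw [Omega, Submodule.mem_inf, Submodule.mem_comap, allowed, allowed, irregular,
    ← Finsupp.supported_union]
  refine and_congr_right fun hx => ?_
  rw [Finsupp.mem_supported']
  constructor
  · intro h p a b q hne hab
    by_cases hw : p ++ a :: b :: q ∈ {l | IsAllowed G (n - 1) l} ∪ {l | IsIrregular (n - 1) l}
    · refine gapSum_eq_zero p a b q fun u => ?_
      rcases hw with hw | hw
      · exact absurd (List.isChain_iff_forall_rel_of_append_cons_cons.1 hw.2 rfl) hab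
      -- As a ≠ b, the repetition in an irregular word lies elsewhere and survives inserting u
      -- between a and b. Without loops no allowed path has one, so every term of the sum vanishes.
      · by_contra h0
        have hl : IsAllowed G n (p ++ a :: u :: b :: q) := hx (Finsupp.mem_support_iff.2 h0)
        refine hw.2 ?_
        have hc : (p ++ a :: u :: b :: q).IsChain (fun a b => a ≠ b) :=
          hl.2.imp fun c d hcd he => hG c (by rwa [← he] at hcd)
        rw [List.isChain_append_cons_cons] at hc ⊢
        rw [List.isChain_cons_cons] at hc
        exact ⟨hc.1, hne, hc.2.2.2⟩
    · have h1 := h _ hw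
      rw [boundary_apply_eq_gapSum hx p q hab] at h1
      rcases neg_one_pow_eq_or R (p.length + 1) with h2 | h2 <;> simpa [h2] using h1
  · intro h w hw
    simp only [Set.mem_union, Set.mem_ofPred_eq, not_or, IsAllowed, IsIrregular, not_and,
      not_not] at hw
    by_cases hel : IsElementary (n - 1) w
    · have h1 := hw.1 hel
      have h2 := hw.2 hel
      rw [List.isChain_iff_forall_rel_of_append_cons_cons] at h1 h2
      push Not at h1
      obtain ⟨a, b, p, q, rfl, hab⟩ := h1
      rw [boundary_apply_eq_gapSum hx p q hab, h p a b q (h2 rfl) hab, mul_zero]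
    · rw [boundary, Finsupp.linearCombination_apply, Finsupp.sum_apply]
      refine Finset.sum_eq_zero fun l hl => ?_
      have hall : IsAllowed G n l := hx hl
      simp only [boundaryPath]
      split_ifs with hlen
      · simp
      · rw [Finsupp.smul_apply, Finsupp.finsetSum_apply, Finset.sum_eq_zero, smul_zero]
        intro i hi
        refine Finsupp.single_eq_of_ne ?_
        rintro rfl
        have h3 := List.length_eraseIdx_of_lt (Finset.mem_range.1 hi)
        have h4 := hall.1.2
        refine hel ⟨fun h0 => ?_, by omega⟩
        rw [h0] at h3
        simp at h3
        omega

/-- Each gap equation involves only paths differing in one interior vertex. A predicate blind to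
that vertex keeps all of them or none. -/
theorem filter_mem_Omega {G : Digraph V} (hG : ∀ v, ¬ G.Adj v v) {n : ℤ} {x : Chain V R}
    (hx : x ∈ Omega G R n) (P : List V → Prop) [DecidablePred P]
    (hP : ∀ p a b q u w, P (p ++ a :: u :: b :: q) → P (p ++ a :: w :: b :: q)) :
    x.filter P ∈ Omega G R n := by
  rw [mem_Omega_iff hG] at hx ⊢
  refine ⟨fun l hl => hx.1 ?_, fun p a b q hne hab => ?_⟩
  · rw [Finset.mem_coe, Finsupp.support_filter, Finset.mem_filter] at hl
    exact hl.1
  · by_cases h : ∃ u, P (p ++ a :: u :: b :: q)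
    · obtain ⟨u, hu⟩ := h
      have : gapSum R p a b q (x.filter fun l => ¬ P l) = 0 :=
        gapSum_eq_zero p a b q fun w => Finsupp.filter_apply_neg _ _ (not_not.2 (hP _ _ _ _ _ _ hu))
      have h2 := hx.2 p a b q hne hab
      rw [← Finsupp.filter_add_filter_not x P, map_add, this, add_zero] at h2
      exact h2
    · push Not at h
      exact gapSum_eq_zero p a b q fun w => Finsupp.filter_apply_neg _ _ (h w)

end Gap

/-! ### Adding and removing an end vertex of a path -/

section SideLists

variable {V : Type*} (s : Side)

theorem Side.face_add (v : V) (l : List V) : s.face (s.add v l) = l := by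
  cases s <;> simp [Side.face, Side.add]

theorem Side.endpoint_add (v : V) (l : List V) : s.endpoint (s.add v l) = some v := by
  cases s <;> simp [Side.endpoint, Side.add]

theorem Side.add_injective (v : V) : Function.Injective (s.add v) :=
  Function.LeftInverse.injective (s.face_add v)

theorem Side.add_face {v : V} {l : List V} (h : s.endpoint l = some v) :
    s.add v (s.face l) = l := by
  cases s
  · exact List.dropLast_append_getLast? v h
  · exact List.cons_head?_tail h

theorem Side.exists_endpoint {l : List V} (hl : l ≠ []) : ∃ v, s.endpoint l = some v := by
  cases s
  · exact ⟨_, List.getLast?_eq_some_getLast hl⟩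
  · exact ⟨_, List.head?_eq_some_head hl⟩

theorem Side.length_add (v : V) (l : List V) : (s.add v l).length = l.length + 1 := by
  cases s <;> simp [Side.add]

theorem Side.isChain_add {G : Digraph V} {v : V} {l : List V} :
    (s.add v l).IsChain G.Adj ↔
      l.IsChain G.Adj ∧ ∀ w, s.endpoint l = some w → s.Adj G w v := by
  cases s
  · simp [Side.add, Side.endpoint, Side.Adj, List.isChain_append]
  · simp [Side.add, Side.endpoint, Side.Adj, List.isChain_cons, and_comm]

theorem Side.isAllowed_add {G : Digraph V} {n : ℤ} {v : V} {l : List V} (hl : l ≠ []) :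
    IsAllowed G n (s.add v l) ↔
      IsAllowed G (n - 1) l ∧ ∀ w, s.endpoint l = some w → s.Adj G w v := by
  have h0 : s.add v l ≠ [] := by
    intro h
    have := s.length_add v l
    simp [h] at this
  rw [IsAllowed, IsAllowed, s.isChain_add, IsElementary, IsElementary, s.length_add, ← and_assoc]
  refine and_congr_left fun _ => and_congr_left fun _ => ?_
  constructor <;> rintro ⟨-, h⟩ <;> refine ⟨by assumption, ?_⟩ <;> push_cast at * <;> omega

end SideLists

/-! ### Gap equations of an extended chain -/

section SideChains

variable {V R : Type*} [CommRing R] (s : Side)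

theorem gapSum_mapDomain_congr {f : List V → List V} {p p' q q' : List V} {a b a' b' : V}
    (h : ∀ l, (∃ u, f l = p ++ a :: u :: b :: q) ↔ ∃ u, l = p' ++ a' :: u :: b' :: q')
    (y : Chain V R) :
    gapSum R p a b q (y.mapDomain f) = gapSum R p' a' b' q' y := by
  induction y using Finsupp.induction_linear with
  | zero => simp
  | add y z hy hz => rw [Finsupp.mapDomain_add, map_add, map_add, hy, hz]
  | single l c =>
    rw [Finsupp.mapDomain_single]
    by_cases hl : ∃ u, l = p' ++ a' :: u :: b' :: q'
    · rw [gapSum_single_of _ _ _ _ _ hl, gapSum_single_of _ _ _ _ _ ((h l).2 hl)]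
    · rw [gapSum_single_of_not _ _ _ _ _ hl, gapSum_single_of_not _ _ _ _ _ fun h' => hl ((h l).1 h')]

/-- For gaps touching the added vertex: the vertex summed over is then the end of a path of y, and
summing over it with the rest l' fixed gives a coefficient of δ_u. -/
theorem gapSum_mapDomain_eq_delta {f : List V → List V} {p q l' : List V} {a b u : V}
    (h : ∀ l, (∃ u, f l = p ++ a :: u :: b :: q) ↔ s.face l = l')
    (hu : s.endpoint l' = some u) (y : Chain V R) :
    gapSum R p a b q (y.mapDomain f) = s.delta u y l' := by
  induction y using Finsupp.induction_linear with
  | zero => simp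
  | add y z hy hz => rw [Finsupp.mapDomain_add, map_add, map_add, hy, hz, Finsupp.add_apply]
  | single l c =>
    rw [Finsupp.mapDomain_single, Side.delta, Finsupp.linearCombination_single]
    by_cases hl : s.face l = l'
    · rw [gapSum_single_of _ _ _ _ _ ((h l).2 hl)]
      simp [hl, hu]
    · rw [gapSum_single_of_not _ _ _ _ _ fun h' => hl ((h l).1 h')]
      split_ifs
      · simp [hl]
      · simp

theorem Side.gapSum_add_eq (v : V) (p : List V) (a b : V) (q : List V) :
    ∃ p' q', ∀ y : Chain V R,
      gapSum R p' a b q' (y.mapDomain (s.add v)) = gapSum R p a b q y := by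
  cases s
  · refine ⟨p, q ++ [v], gapSum_mapDomain_congr fun l => exists_congr fun u => ?_⟩
    rw [show p ++ a :: u :: b :: (q ++ [v]) = (p ++ a :: u :: b :: q) ++ [v] by simp]
    exact List.append_cancel_right_eq .. |>.to_iff
  · exact ⟨v :: p, q, gapSum_mapDomain_congr fun l => by simp [Side.add]⟩

theorem Side.delta_eq_gapSum {G : Digraph V} {u v : V} (huv : u ≠ v) (hadj : ¬ s.Adj G u v)
    {l : List V} (hl : s.endpoint l = some u) :
    ∃ p a b q, a ≠ b ∧ ¬ G.Adj a b ∧ ∀ y : Chain V R,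
      gapSum R p a b q (y.mapDomain (s.add v)) = s.delta u y l := by
  cases s
  · refine ⟨l.dropLast, u, v, [], huv, hadj, gapSum_mapDomain_eq_delta .upper (fun l' => ?_) hl⟩
    have hl' : l.dropLast ++ [u] = l := Side.add_face .upper hl
    simp only [Side.add, Side.face]
    constructor
    · rintro ⟨w, h⟩
      have : l' = l ++ [w] := by
        rw [← hl']
        exact List.append_cancel_right (bs := [v]) (by simpa using h)
      simp [this]
    · intro h
      have : l' ≠ [] := by
        rintro rfl
        rw [← show [] = l from h] at hl
        simp [Side.endpoint] at hl
      refine ⟨l'.getLast this, ?_⟩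
      conv_lhs => rw [← List.dropLast_append_getLast this, h, ← hl']
      simp
  · refine ⟨[], v, u, l.tail, huv.symm, hadj,
      gapSum_mapDomain_eq_delta .lower (fun l' => ?_) hl⟩
    have hl' : u :: l.tail = l := Side.add_face .lower hl
    simp only [Side.add, Side.face, hl']
    constructor
    · rintro ⟨w, h⟩
      simp only [List.nil_append, List.cons.injEq, true_and] at h
      simp [h]
    · intro h
      cases l' with
      | nil => simp [← h] at hl'
      | cons w l' => exact ⟨w, by simp_all⟩

/-- The cases: the word does not have v at the relevant end; it does, and the gap avoids that v,
leaving a gap of y; or v bounds the gap, and the equation is a coefficient of a face of y. -/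
theorem Side.gapSum_mapDomain_add {G : Digraph V} (v : V) (p : List V) {a b : V} (q : List V)
    (hne : a ≠ b) (hadj : ¬ G.Adj a b) :
    (∀ y : Chain V R, gapSum R p a b q (y.mapDomain (s.add v)) = 0) ∨
    (∃ p' q', ∀ y : Chain V R,
      gapSum R p a b q (y.mapDomain (s.add v)) = gapSum R p' a b q' y) ∨
    ∃ u l, u ≠ v ∧ ¬ s.Adj G u v ∧ ∀ y : Chain V R,
      gapSum R p a b q (y.mapDomain (s.add v)) = s.delta u y l := by
  have zero : ∀ {p a b q}, (∀ l u, s.add v l ≠ p ++ a :: u :: b :: q) →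
      ∀ y : Chain V R, gapSum R p a b q (y.mapDomain (s.add v)) = 0 := by
    intro p a b q h y
    induction y using Finsupp.induction_linear with
    | zero => simp
    | add y z hy hz => rw [Finsupp.mapDomain_add, map_add, hy, hz, add_zero]
    | single l c =>
      rw [Finsupp.mapDomain_single]
      exact gapSum_single_of_not _ _ _ _ _ fun ⟨u, hu⟩ => h l u hu
  cases s
  · rcases List.eq_nil_or_concat q with rfl | ⟨q, w, rfl⟩
    · by_cases hb : b = v
      · subst hb
        refine Or.inr (Or.inr ⟨a, p ++ [a], hne, hadj, ?_⟩)
        refine gapSum_mapDomain_eq_delta .upper (fun l' => ?_) (by simp [Side.endpoint])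
        simp only [Side.add, Side.face]
        constructor
        · rintro ⟨w, h⟩
          have : l' = (p ++ [a]) ++ [w] :=
            List.append_cancel_right (bs := [b]) (by simpa using h)
          simp [this]
        · intro h
          have : l' ≠ [] := by
            rintro rfl
            simp at h
          refine ⟨l'.getLast this, ?_⟩
          conv_lhs => rw [← List.dropLast_append_getLast this, h]
          simp
      · refine Or.inl (zero fun l u h => hb ?_)
        have := congrArg List.getLast? h
        simp only [Side.add, List.getLast?_append, List.getLast?_cons] at this
        simpa using this.symm
    · rw [List.concat_eq_append]
      by_cases hw : w = v
      · subst hw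
        refine Or.inr (Or.inl ⟨p, q, gapSum_mapDomain_congr fun l => exists_congr fun u => ?_⟩)
        rw [show p ++ a :: u :: b :: (q ++ [w]) = (p ++ a :: u :: b :: q) ++ [w] by simp]
        exact List.append_cancel_right_eq .. |>.to_iff
      · refine Or.inl (zero fun l u h => hw ?_)
        have := congrArg List.getLast? h
        simp only [Side.add, List.getLast?_append, List.getLast?_cons] at this
        simpa using this.symm
  · rcases p with _ | ⟨w, p⟩
    · by_cases ha : a = v
      · subst ha
        refine Or.inr (Or.inr ⟨b, b :: q, hne.symm, hadj, ?_⟩)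
        refine gapSum_mapDomain_eq_delta .lower (fun l' => ?_) (by simp [Side.endpoint])
        simp only [Side.add, Side.face]
        cases l' with
        | nil => simp
        | cons w l' => simp
      · refine Or.inl (zero fun l u h => ha ?_)
        simp only [Side.add, List.nil_append, List.cons.injEq] at h
        exact h.1.symm
    · by_cases hw : w = v
      · subst hw
        exact Or.inr (Or.inl ⟨p, q, gapSum_mapDomain_congr fun l => by simp [Side.add]⟩)
      · refine Or.inl (zero fun l u h => hw ?_)
        simp only [Side.add, List.cons_append, List.cons.injEq] at h
        exact h.1.symm

theorem Side.delta_apply_of_ne {u : V} {l : List V} (hl : s.endpoint l ≠ some u)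
    (y : Chain V R) : s.delta u y l = 0 := by
  induction y using Finsupp.induction_linear with
  | zero => simp
  | add y z hy hz => rw [map_add, Finsupp.add_apply, hy, hz, add_zero]
  | single l' c =>
    rw [Side.delta, Finsupp.linearCombination_single]
    split_ifs with h
    · have : s.face l' ≠ l := fun h' => hl (h' ▸ h)
      simp [this]
    · simp

theorem Side.mapDomain_add_mem_allowed {G : Digraph V} {n : ℤ} {v : V} {y : Chain V R}
    (hy0 : ∀ l ∈ y.support, l ≠ []) (hadj : ∀ w ∈ s.ends y, s.Adj G w v) :
    y.mapDomain (s.add v) ∈ allowed G R n ↔ y ∈ allowed G R (n - 1) := by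
  classical
  rw [allowed, allowed, Finsupp.mem_supported, Finsupp.mem_supported,
    Finsupp.mapDomain_support_of_injective (s.add_injective v)]
  simp only [Finset.coe_image, Set.image_subset_iff]
  refine forall₂_congr fun l hl => ?_
  exact (s.isAllowed_add (hy0 l hl)).trans
    ⟨fun h => h.1, fun h => ⟨h, fun w hw => hadj w ⟨l, hl, hw⟩⟩⟩

/-- Appending a common end `v` to the paths of `y` gives an element of `Ω_n` if and only if `y` lies
in `Ω_{n-1}` and its faces `δ_u y` vanish for all `u` that are not joined to `v`. -/
theorem Side.mapDomain_add_mem_Omega {G : Digraph V} (hG : ∀ v, ¬ G.Adj v v) {n : ℤ} {v : V}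
    {y : Chain V R} (hy0 : ∀ l ∈ y.support, l ≠ []) (hadj : ∀ w ∈ s.ends y, s.Adj G w v) :
    y.mapDomain (s.add v) ∈ Omega G R n ↔
      y ∈ Omega G R (n - 1) ∧ ∀ u, u ≠ v → ¬ s.Adj G u v → s.delta u y = 0 := by
  rw [mem_Omega_iff hG, mem_Omega_iff hG, s.mapDomain_add_mem_allowed hy0 hadj, and_assoc]
  refine and_congr_right fun _ => ?_
  constructor
  · intro h
    refine ⟨fun p a b q hne hab => ?_, fun u hu hadj => ?_⟩
    · obtain ⟨p', q', h'⟩ := s.gapSum_add_eq (R := R) v p a b q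
      rw [← h', h _ _ _ _ hne hab]
    · ext l
      by_cases hl : s.endpoint l = some u
      · obtain ⟨p, a, b, q, hne, hab, h'⟩ := s.delta_eq_gapSum (R := R) hu hadj hl
        rw [← h', h _ _ _ _ hne hab, Finsupp.zero_apply]
      · rw [s.delta_apply_of_ne hl, Finsupp.zero_apply]
  · rintro ⟨h1, h2⟩ p a b q hne hab
    rcases s.gapSum_mapDomain_add (R := R) v p q hne hab with h | ⟨p', q', h⟩ | ⟨u, l, hu, hadj, h⟩
    · exact h y
    · rw [h, h1 _ _ _ _ hne hab]
    · rw [h, h2 u hu hadj, Finsupp.zero_apply]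

end SideChains

/-! ### Decomposition of Ω_n by ends, and faces -/

section Faces

variable {V R : Type*} [CommRing R] (s : Side)

theorem eq_sum_filter_fiber {α β M : Type*} [AddCommMonoid M] [DecidableEq β] (x : α →₀ M) (f : α → β) :
    x = ∑ c ∈ x.support.image f, x.filter fun a => f a = c := by
  ext a
  rw [Finsupp.finsetSum_apply]
  simp only [Finsupp.filter_apply, Finset.sum_ite_eq]
  split_ifs with h
  · rfl
  · by_contra h0
    exact h (Finset.mem_image_of_mem f (Finsupp.mem_support_iff.2 h0))

theorem ne_nil_of_mem_support {G : Digraph V} {n : ℤ} {y : Chain V R} (hy : y ∈ Omega G R n)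
    {l : List V} (hl : l ∈ y.support) : l ≠ [] :=
  (show IsAllowed G n l from hy.1 hl).1.1

theorem Side.extend_eq_mapDomain {G : Digraph V} {n : ℤ} {v : V} {y : Chain V R}
    (hy : y ∈ allowed G R n) (hadj : ∀ w ∈ s.ends y, s.Adj G w v) :
    s.extend G v y = y.mapDomain (s.add v) := by
  rw [Side.extend, Finsupp.linearCombination_apply, Finsupp.mapDomain]
  refine Finset.sum_congr rfl fun l hl => ?_
  have hall : IsAllowed G n l := hy hl
  dsimp only
  rw [if_pos (s.isChain_add.2 ⟨hall.2, fun w hw => hadj w ⟨l, hl, hw⟩⟩)]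
  simp

open Classical in
theorem Side.delta_mapDomain_add (u v : V) (y : Chain V R) :
    s.delta u (y.mapDomain (s.add v)) = y.filter fun l => s.endpoint l = some u := by
  induction y using Finsupp.induction_linear with
  | zero => rw [Finsupp.mapDomain_zero, map_zero, Finsupp.filter_zero]
  | add y z hy hz => rw [Finsupp.mapDomain_add, map_add, hy, hz, Finsupp.filter_add]
  | single l c =>
    rw [Finsupp.mapDomain_single, Side.delta, Finsupp.linearCombination_single, s.face_add]
    split_ifs with h
    · rw [Finsupp.filter_single_of_pos (fun l => s.endpoint l = some u) h]
      simp
    · rw [Finsupp.filter_single_of_neg (fun l => s.endpoint l = some u) h, smul_zero]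

theorem Side.exists_face {G : Digraph V} (hG : ∀ v, ¬ G.Adj v v) {n : ℤ} (hn : 1 ≤ n) {v : V}
    {x : Chain V R} (hx : x ∈ Omega G R n) (hv : ∀ l ∈ x.support, s.endpoint l = some v) :
    ∃ y ∈ Omega G R (n - 1), (∀ w ∈ s.ends y, s.Adj G w v) ∧
      (∀ u, u ≠ v → ¬ s.Adj G u v → s.delta u y = 0) ∧ x = y.mapDomain (s.add v) := by
  classical
  have hxy : x = (x.mapDomain s.face).mapDomain (s.add v) := by
    rw [← Finsupp.mapDomain_comp]
    conv_lhs => rw [← Finsupp.mapDomain_id (v := x)]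
    exact Finsupp.mapDomain_congr fun l hl => (s.add_face (hv l hl)).symm
  have hsupp : ∀ l ∈ (x.mapDomain s.face).support, ∃ l' ∈ x.support, l' = s.add v l := by
    intro l hl
    obtain ⟨l', hl', rfl⟩ := Finset.mem_image.1 (Finsupp.mapDomain_support hl)
    exact ⟨l', hl', (s.add_face (hv l' hl')).symm⟩
  -- Here n ≥ 1 is needed: paths of x have at least two vertices.
  have hne : ∀ l ∈ (x.mapDomain s.face).support, l ≠ [] := by
    rintro l hl rfl
    obtain ⟨l', hl', rfl⟩ := hsupp _ hl
    have h1 : IsAllowed G n (s.add v []) := hx.1 hl'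
    have h2 := h1.1.2
    rw [s.length_add] at h2
    simp at h2
    omega
  have hadj : ∀ w ∈ s.ends (x.mapDomain s.face), s.Adj G w v := by
    rintro w ⟨l, hl, hw⟩
    obtain ⟨l', hl', rfl⟩ := hsupp _ hl
    exact (s.isChain_add.1 (show IsAllowed G n (s.add v l) from hx.1 hl').2).2 w hw
  have h := hx
  rw [hxy, s.mapDomain_add_mem_Omega hG hne hadj] at h
  exact ⟨_, h.1, hadj, h.2, hxy⟩

theorem Side.endpoint_interior (p : List V) (a b : V) (q : List V) (u w : V) :
    s.endpoint (p ++ a :: u :: b :: q) = s.endpoint (p ++ a :: w :: b :: q) := by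
  cases s
  · simp [Side.endpoint, List.getLast?_append, List.getLast?_cons]
  · simp [Side.endpoint, List.head?_append]

open Classical in
theorem Side.filter_endpoint_mem_Omega {G : Digraph V} (hG : ∀ v, ¬ G.Adj v v) {n : ℤ}
    {x : Chain V R} (hx : x ∈ Omega G R n) (o : Option V) :
    (x.filter fun l => s.endpoint l = o) ∈ Omega G R n :=
  filter_mem_Omega hG hx _ fun p a b q u w h => by rwa [s.endpoint_interior p a b q w u]

/-- An element of `Ω_n` is a sum of chains obtained by joining a vertex to all ends of a chain. -/
theorem Side.Omega_induction {G : Digraph V} (hG : ∀ v, ¬ G.Adj v v) {n : ℤ} (hn : 1 ≤ n)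
    {M : Type*} [AddCommGroup M] [Module R M] (f : Chain V R →ₗ[R] M) (N : Submodule R M)
    (h : ∀ v, ∀ y ∈ Omega G R (n - 1), (∀ w ∈ s.ends y, s.Adj G w v) →
      (∀ u, u ≠ v → ¬ s.Adj G u v → s.delta u y = 0) → f (y.mapDomain (s.add v)) ∈ N)
    {x : Chain V R} (hx : x ∈ Omega G R n) : f x ∈ N := by
  classical
  rw [eq_sum_filter_fiber x s.endpoint, map_sum]
  refine N.sum_mem fun o ho => ?_
  obtain ⟨l, hl, rfl⟩ := Finset.mem_image.1 ho
  obtain ⟨v, hv⟩ := s.exists_endpoint (ne_nil_of_mem_support hx hl)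
  rw [hv]
  obtain ⟨y, hy, hadj, hδ, h'⟩ := s.exists_face hG hn (v := v)
    (s.filter_endpoint_mem_Omega hG hx (some v)) (by simp [Finsupp.support_filter])
  rw [h']
  exact h v y hy hadj hδ

/-- On the extension of y by a vertex, δ_u merely selects the paths of y with end u, and such a
selection stays in Ω. For n < 1 the face of a path is empty, has no end, and δ_u vanishes. -/
theorem Side.delta_mem_Omega {G : Digraph V} (hG : ∀ v, ¬ G.Adj v v) {n : ℤ} (u : V)
    {x : Chain V R} (hx : x ∈ Omega G R n) : s.delta u x ∈ Omega G R (n - 1) := by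
  classical
  rcases lt_or_ge n 1 with hn | hn
  · convert (Omega G R (n - 1)).zero_mem
    rw [Side.delta, Finsupp.linearCombination_apply]
    refine Finset.sum_eq_zero fun l hl => ?_
    have hall : IsAllowed G n l := hx.1 hl
    have hlen := hall.1.2
    obtain ⟨v, hv⟩ := s.exists_endpoint hall.1.1
    have h1 := s.length_add v (s.face l)
    rw [s.add_face hv] at h1
    have h2 : s.face l = [] := List.length_eq_zero_iff.1 (by omega)
    dsimp only
    rw [h2]
    cases s <;> simp [Side.endpoint]
  · refine s.Omega_induction hG hn (s.delta u) _ (fun v y hy _ _ => ?_) hx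
    rw [s.delta_mapDomain_add]
    exact s.filter_endpoint_mem_Omega hG hy _

/-- This is where the bigrading of the basis enters. Each piece of y with fixed tail and head is
spanned by basis elements with the same tail and head, so no new ends appear. -/
theorem Side.mem_span_adj {G : Digraph V} (hG : ∀ v, ¬ G.Adj v v) {n : ℤ}
    {B : Set (Chain V R)} (hB : IsBigradedBasis G n B) {v : V} {y : Chain V R}
    (hy : y ∈ Omega G R n) (hadj : ∀ w ∈ s.ends y, s.Adj G w v) :
    y ∈ Submodule.span R {b ∈ B | ∀ w ∈ s.ends b, s.Adj G w v} := by
  classical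
  rw [eq_sum_filter_fiber y fun l => (Side.lower.endpoint l, Side.upper.endpoint l)]
  refine Submodule.sum_mem _ fun o ho => ?_
  obtain ⟨l, hl, rfl⟩ := Finset.mem_image.1 ho
  obtain ⟨a, ha⟩ := Side.lower.exists_endpoint (ne_nil_of_mem_support hy hl)
  obtain ⟨b, hb⟩ := Side.upper.exists_endpoint (ne_nil_of_mem_support hy hl)
  have hmem : (y.filter fun l' => (Side.lower.endpoint l', Side.upper.endpoint l') =
      (Side.lower.endpoint l, Side.upper.endpoint l)) ∈ OmegaBi G R n a b := by
    refine ⟨filter_mem_Omega hG hy _ fun p a b q u w h => ?_, ?_⟩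
    · rwa [Side.endpoint_interior .lower p a b q w u, Side.endpoint_interior .upper p a b q w u]
    · intro l' hl'
      rw [Finset.mem_coe, Finsupp.support_filter, Finset.mem_filter, Prod.mk.injEq, ha, hb] at hl'
      exact hl'.2
  rw [← (hB.2 a b).2] at hmem
  refine Submodule.span_mono ?_ hmem
  rintro z ⟨hz, hz'⟩
  refine ⟨hz, ?_⟩
  rintro w ⟨l', hl', hw⟩
  have h1 : l'.head? = some a ∧ l'.getLast? = some b := hz'.2 hl'
  refine hadj w ⟨l, hl, ?_⟩
  cases s
  · exact hb.trans (h1.2.symm.trans hw)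
  · exact ha.trans (h1.1.symm.trans hw)

end Faces

/-! ### Signed basis decompositions and zero blocks -/

section Decompositions

/-- Every element of `R` is a multiple `± k` of one such that no `j` with `0 < j ≤ k` vanishes in
`R`. -/
def HasSignedMultiples (R : Type*) [CommRing R] : Prop :=
  ∀ r : R, ∃ (k : ℕ) (ε : R), (ε = 1 ∨ ε = -1) ∧ r = k * ε ∧ ∀ j : ℕ, 0 < j → j ≤ k → (j : R) ≠ 0

theorem hasSignedMultiples_int : HasSignedMultiples ℤ := by
  intro r
  obtain ⟨k, rfl | rfl⟩ := r.eq_nat_or_neg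
  · exact ⟨k, 1, Or.inl rfl, by simp, fun j hj _ => by exact_mod_cast hj.ne'⟩
  · exact ⟨k, -1, Or.inr rfl, by simp, fun j hj _ => by exact_mod_cast hj.ne'⟩

/-- The representative of r in [0, p) serves as k: no positive j below p is divisible by p. -/
theorem hasSignedMultiples_zmod (p : ℕ) [NeZero p] : HasSignedMultiples (ZMod p) := by
  intro r
  refine ⟨r.val, 1, Or.inl rfl, by simp, fun j hj hjr h => ?_⟩
  rw [ZMod.natCast_eq_zero_iff] at h
  exact absurd (Nat.le_of_dvd hj h) (not_le.2 (hjr.trans_lt r.val_lt))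

variable {R N : Type*} [CommRing R] [AddCommGroup N] [Module R N]

/-- Lifts a relation to the free module, where coefficients can be compared even though the same
basis element may occur for several indices. -/
theorem sum_single_eq_zero {B : Set N} (hB : LinearIndependent R (Subtype.val : B → N)) {ι : Type*}
    {t : Finset ι} {b : ι → B} {ε : ι → R} (h : ∑ i ∈ t, ε i • (b i : N) = 0) :
    ∑ i ∈ t, Finsupp.single (b i) (ε i) = 0 := by
  refine hB ?_
  rw [map_sum, map_zero, ← h]
  simp

theorem exists_signed_decomposition (hR : HasSignedMultiples R) {B : Set N}
    (hB : LinearIndependent R (Subtype.val : B → N)) {z : N} (hz : z ∈ Submodule.span R B) :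
    ∃ (c : ℕ) (x : Fin c → N), (∀ k, x k ∈ B ∨ - x k ∈ B) ∧ z = ∑ k, x k ∧
      ∀ t : Finset (Fin c), t.Nonempty → ∑ k ∈ t, x k ≠ 0 := by
  classical
  obtain ⟨f, rfl⟩ := (Finsupp.mem_span_iff_linearCombination R B z).1 hz
  choose k ε hε hr hk using hR
  let e := Fintype.equivFin (Σ b : f.support, Fin (k (f b)))
  let y : (Σ b : f.support, Fin (k (f b))) → N := fun i => ε (f i.1) • (i.1.1 : N)
  -- All copies of one basis element carry the same sign. In a nonempty subsum its coefficient is ±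
  -- the number j of chosen copies, with 0 < j ≤ k, hence nonzero.
  have hy : ∀ t : Finset (Σ b : f.support, Fin (k (f b))), t.Nonempty → ∑ i ∈ t, y i ≠ 0 := by
    rintro t ⟨i, hi⟩ h
    have h1 := DFunLike.congr_fun (sum_single_eq_zero hB (b := fun i : (Σ b : f.support,
      Fin (k (f b))) => i.1.1) (ε := fun i => ε (f i.1)) h) i.1.1
    simp only [Finsupp.finsetSum_apply, Finsupp.single_apply, Finsupp.zero_apply] at h1
    have h2 : ∀ i' ∈ t, (if i'.1.1 = i.1.1 then ε (f i'.1) else 0) =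
        if i'.1 = i.1 then ε (f i.1) else 0 := by
      intro i' _
      by_cases h : i'.1 = i.1
      · simp [h]
      · rw [if_neg h, if_neg fun h' => h (Subtype.ext h')]
    rw [Finset.sum_congr rfl h2, ← Finset.sum_filter, Finset.sum_const, nsmul_eq_mul] at h1
    refine hk (f i.1) (t.filter fun i' => i'.1 = i.1).card
      (Finset.card_pos.2 ⟨i, by simp [hi]⟩) ?_ ?_
    · calc _ ≤ ((Finset.univ : Finset (Fin (k (f i.1)))).map
              (Function.Embedding.sigmaMk (β := fun b : f.support => Fin (k (f b))) i.1)).card := by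
            refine Finset.card_le_card ?_
            rintro ⟨b, j⟩ hb
            obtain rfl : b = i.1 := (Finset.mem_filter.1 hb).2
            simp
        _ = _ := by simp
    · rcases hε (f i.1) with h | h <;> simpa [h] using h1
  refine ⟨_, y ∘ e.symm, fun j => ?_, ?_, fun t ht => ?_⟩
  · rcases hε (f (e.symm j).1) with h | h <;> simp [y, h]
  · simp only [Function.comp_apply]
    rw [Equiv.sum_comp e.symm y, Fintype.sum_sigma, Finsupp.linearCombination_apply, Finsupp.sum,
      ← Finset.sum_coe_sort]
    refine Finset.sum_congr rfl fun b _ => ?_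
    simp only [y, Finset.sum_const, Finset.card_univ, Fintype.card_fin]
    conv_lhs => rw [hr (f b)]
    rw [mul_smul, Nat.cast_smul_eq_nsmul]
  · have := hy (t.map e.symm.toEmbedding) (by simpa using ht)
    simpa using this

/-- A pair of opposite values, or at least three equal values with sum zero. -/
def IsZeroBlock {α : Type*} (val : α → N) (e : Finset α) : Prop :=
  (∃ a b, a ≠ b ∧ val a = - val b ∧ ∀ c, c ∈ e ↔ c = a ∨ c = b) ∨
    (3 ≤ e.card ∧ (∀ a ∈ e, ∀ b ∈ e, val a = val b) ∧ ∑ a ∈ e, val a = 0)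

theorem IsZeroBlock.sum_eq_zero {α : Type*} {val : α → N} {e : Finset α}
    (h : IsZeroBlock val e) : ∑ a ∈ e, val a = 0 := by
  classical
  rcases h with ⟨a, b, hab, hval, he⟩ | h
  · obtain rfl : e = {a, b} := by ext; simp [he]
    rw [Finset.sum_pair hab, hval, neg_add_cancel]
  · exact h.2.2

theorem IsZeroBlock.nonempty {α : Type*} {val : α → N} {e : Finset α}
    (h : IsZeroBlock val e) : e.Nonempty := by
  rcases h with ⟨a, b, hab, hval, he⟩ | h
  · exact ⟨a, (he a).2 (Or.inl rfl)⟩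
  · exact Finset.card_pos.1 (by omega)

/-- Pick any index a. If no other index has the opposite value, then all terms over the basis
element of a equal `val a`, and their number must vanish in R. -/
theorem exists_isZeroBlock [Nontrivial R] {B : Set N}
    (hB : LinearIndependent R (Subtype.val : B → N)) {α : Type*} {val : α → N}
    (hval : ∀ a, val a ∈ B ∨ - val a ∈ B) {S : Finset α} (hS : S.Nonempty) (h0 : ∑ a ∈ S, val a = 0) :
    ∃ e ⊆ S, IsZeroBlock val e := by
  classical
  obtain ⟨a, ha⟩ := hS
  by_cases hpair : ∃ c ∈ S, a ≠ c ∧ val a = - val c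
  · obtain ⟨c, hc, hac, h⟩ := hpair
    exact ⟨{a, c}, by simp [Finset.insert_subset_iff, ha, hc], Or.inl ⟨a, c, hac, h, by simp⟩⟩
  push Not at hpair
  have hsign : ∀ c, ∃ (b : B) (ε : R), (ε = 1 ∨ ε = -1) ∧ val c = ε • (b : N) := by
    intro c
    rcases hval c with h | h
    · exact ⟨⟨_, h⟩, 1, Or.inl rfl, by simp⟩
    · exact ⟨⟨_, h⟩, -1, Or.inr rfl, by simp⟩
  choose b ε hε hb using hsign
  have h1 : ∑ c ∈ S, ε c • (b c : N) = 0 := by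
    rw [← h0]
    exact Finset.sum_congr rfl fun c _ => (hb c).symm
  have h2 := DFunLike.congr_fun (sum_single_eq_zero hB h1) (b a)
  simp only [Finsupp.finsetSum_apply, Finsupp.single_apply, Finsupp.zero_apply] at h2
  have h3 : ∀ c ∈ S, (if b c = b a then ε c else 0) = if val c = val a then ε a else 0 := by
    intro c hc
    by_cases hbc : b c = b a
    · rw [if_pos hbc]
      split_ifs with hv
      · have h : Finsupp.single (b c) (ε c) = Finsupp.single (b a) (ε a) :=
          hB (by simpa [← hb] using hv)
        rw [hbc] at h
        exact Finsupp.single_injective _ h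
      · exfalso
        have hca : a ≠ c := by rintro rfl; exact hv rfl
        have hn := hpair c hc hca
        rw [hb c, hb a, hbc] at hv hn
        rcases hε a with h | h <;> rcases hε c with h' | h' <;> simp [h, h'] at hv hn
    · rw [if_neg hbc]
      split_ifs with hv
      · exfalso
        have h : Finsupp.single (b c) (ε c) = Finsupp.single (b a) (ε a) :=
          hB (by simpa [← hb] using hv)
        rcases Finsupp.single_eq_single_iff .. |>.1 h with h | h
        · exact hbc h.1
        · rcases hε a with h' | h' <;> simp [h'] at h
      · rfl
  rw [Finset.sum_congr rfl h3, ← Finset.sum_filter, Finset.sum_const, nsmul_eq_mul] at h2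
  have h4 : ((S.filter fun c => val c = val a).card : R) = 0 := by
    rcases hε a with h | h <;> simpa [h] using h2
  have hmem : a ∈ S.filter fun c => val c = val a := by simp [ha]
  have heq : ∀ c ∈ S.filter fun c => val c = val a, val c = val a :=
    fun c hc => (Finset.mem_filter.1 hc).2
  have hsum : ∑ c ∈ S.filter (fun c => val c = val a), val c = 0 := by
    rw [Finset.sum_congr rfl heq, Finset.sum_const, ← Nat.cast_smul_eq_nsmul R, h4, zero_smul]
  refine ⟨_, Finset.filter_subset _ _, Or.inr ⟨?_, fun c hc d hd =>
    (heq c hc).trans (heq d hd).symm, hsum⟩⟩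
  -- One term is excluded since 1 ≠ 0. With two terms 2 = 0 in R, so equal values are also opposite,
  -- contradicting the absence of a pair.
  by_contra! hlt
  have hpos := Finset.card_pos.2 ⟨a, hmem⟩
  interval_cases hcard : (S.filter fun c => val c = val a).card
  · simp at h4
  · obtain ⟨d, hd, hda⟩ := Finset.exists_mem_ne (by omega) a (s := S.filter fun c => val c = val a)
    refine hpair d (Finset.mem_filter.1 hd).1 hda.symm ?_
    rw [heq d hd, eq_neg_iff_add_eq_zero, ← two_smul R]
    rw [show (2 : R) = 0 by exact_mod_cast h4, zero_smul]

/-- A family of signed basis elements with sum zero can be partitioned into zero blocks. -/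
theorem exists_zeroBlock_partition [Nontrivial R] {B : Set N}
    (hB : LinearIndependent R (Subtype.val : B → N)) {α : Type*} {val : α → N}
    (hval : ∀ a, val a ∈ B ∨ - val a ∈ B)
    (S : Finset α) (h0 : ∑ a ∈ S, val a = 0) :
    ∃ P : Set (Finset α), (∀ e ∈ P, IsZeroBlock val e) ∧ (∀ e ∈ P, ∀ f ∈ P, e ≠ f → Disjoint e f) ∧
      ∀ a, a ∈ S ↔ ∃ e ∈ P, a ∈ e := by
  classical
  induction S using Finset.strongInduction with
  | H S ih =>
    rcases S.eq_empty_or_nonempty with rfl | hS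
    · exact ⟨∅, by simp⟩
    obtain ⟨e, heS, he⟩ := exists_isZeroBlock hB hval hS h0
    have h1 := Finset.sum_sdiff (f := val) heS
    rw [he.sum_eq_zero, add_zero, h0] at h1
    obtain ⟨P, hP, hdisj, hcov⟩ := ih (S \ e) (Finset.sdiff_ssubset heS he.nonempty) h1
    have hd : ∀ f ∈ P, Disjoint e f := fun f hf => Finset.disjoint_left.2 fun a hae haf =>
      (Finset.mem_sdiff.1 ((hcov a).2 ⟨f, hf, haf⟩)).2 hae
    refine ⟨insert e P, ?_, ?_, fun a => ?_⟩
    · rintro f (rfl | hf)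
      exacts [he, hP f hf]
    · rintro f (rfl | hf) g (rfl | hg) hne
      exacts [absurd rfl hne, hd g hg, (hd f hf).symm, hdisj f hf g hg hne]
    · rw [Set.exists_mem_insert, ← hcov, Finset.mem_sdiff]
      by_cases ha : a ∈ e
      · simp [ha, heS ha]
      · simp [ha]

end Decompositions

/-! ### Mutations, completeness and components -/

namespace FaceData

variable {V : Type*} {G : Digraph V} {R : Type*} [CommRing R] {s : Side} {n : ℤ}

/-- The summands that are used by the hyperedges with labels in `E`. -/
def covered (D : FaceData G R s n) (E : Set D.Label) : Set (Σ u, D.Slot u) :=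
  ⋃ e ∈ E, Sigma.mk e.1 '' (e.2 : Set (D.Slot e.1))

theorem mem_covered {D : FaceData G R s n} {E : Set D.Label} {u : V} {a : D.Slot u} :
    (⟨u, a⟩ : Σ u, D.Slot u) ∈ D.covered E ↔ ∃ e, (⟨u, e⟩ : D.Label) ∈ E ∧ a ∈ e := by
  simp only [covered, Set.mem_iUnion]
  constructor
  · rintro ⟨⟨w, e⟩, he, b, hb, h⟩
    obtain ⟨rfl, h⟩ := Sigma.mk.inj_iff.1 h
    obtain rfl := eq_of_heq h
    exact ⟨e, he, hb⟩
  · rintro ⟨e, he, ha⟩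
    exact ⟨⟨u, e⟩, he, a, ha, rfl⟩

theorem covered_exchange {D : FaceData G R s n} {E A A' : Set D.Label} (hA : A ⊆ E)
    (h : D.covered A' = D.covered A) : D.covered ((E \ A) ∪ A') = D.covered E := by
  conv_rhs => rw [← Set.sdiff_union_of_subset hA]
  rw [covered, covered, Set.biUnion_union, Set.biUnion_union]
  exact congrArg _ h

theorem EdgeMutation.covered_eq {D : FaceData G R s n} {E E' : Set D.Label}
    (h : D.EdgeMutation E E') : D.covered E' = D.covered E := by
  obtain ⟨u, a, b, a', b', -, h1, h2, rfl⟩ := h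
  refine covered_exchange (Set.insert_subset h1 (Set.singleton_subset_iff.2 h2)) ?_
  simp only [covered, Set.biUnion_insert, Set.biUnion_singleton, ← Set.image_union]
  congr 1
  ext c
  simp
  tauto

theorem SplitMutation.covered_eq {D : FaceData G R s n} {E E' : Set D.Label}
    (h : D.SplitMutation E E') : D.covered E' = D.covered E := by
  obtain ⟨u, e, f, σ, -, -, h1, h2, rfl⟩ := h
  refine covered_exchange (Set.insert_subset h1 (Set.singleton_subset_iff.2 h2)) ?_
  rw [covered, covered, Set.biUnion_range, Set.biUnion_insert, Set.biUnion_singleton,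
    ← Set.image_union]
  change ⋃ y : e, Sigma.mk u '' (({(y : D.Slot u), (σ y : D.Slot u)} : Finset (D.Slot u)) :
    Set (D.Slot u)) = Sigma.mk u '' _
  rw [← Set.image_iUnion]
  congr 1
  ext c
  simp only [Finset.coe_insert, Finset.coe_singleton, Set.mem_iUnion, Set.mem_insert_iff,
    Set.mem_singleton_iff, Set.mem_union, Finset.mem_coe]
  constructor
  · rintro ⟨a, rfl | rfl⟩
    exacts [Or.inl a.2, Or.inr (σ a).2]
  · rintro (hc | hc)
    exacts [⟨⟨c, hc⟩, Or.inl rfl⟩, ⟨σ.symm ⟨c, hc⟩, Or.inr (by simp)⟩]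

theorem ShuffleMutation.covered_eq {D : FaceData G R s n} {E E' : Set D.Label}
    (h : D.ShuffleMutation E E') : D.covered E' = D.covered E := by
  obtain ⟨u, e, f, e', f', -, -, -, h1, h2, -, -, -, h3, rfl⟩ := h
  refine covered_exchange (Set.insert_subset h1 (Set.singleton_subset_iff.2 h2)) ?_
  simp only [covered, Set.biUnion_insert, Set.biUnion_singleton, ← Set.image_union,
    ← Finset.coe_union, h3]

/-- Every mutation redistributes exactly the summands of the hyperedges it removes. The first claim
is an equivalence because a reflexive step says nothing about `E`. -/
theorem eqvGen_mutation {D : FaceData G R s n} {E E' : Set D.Label}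
    (h : Relation.EqvGen D.Mutation E E') :
    (D.IsFaceMultihypergraph E ↔ D.IsFaceMultihypergraph E') ∧ D.covered E = D.covered E' := by
  induction h with
  | rel E E' h =>
    refine ⟨iff_of_true h.1 h.2.1, ?_⟩
    rcases h.2.2 with h | h | h | h
    exacts [h.covered_eq.symm, h.covered_eq.symm, h.covered_eq, h.covered_eq.symm]
  | refl E => exact ⟨Iff.rfl, rfl⟩
  | symm E E' _ h => exact ⟨h.1.symm, h.2.symm⟩
  | trans E E' E'' _ _ h h' => exact ⟨h.1.trans h'.1, h.2.trans h'.2⟩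

theorem IsFaceMultihypergraph.isZeroBlock {D : FaceData G R s n} {E : Set D.Label}
    (hE : D.IsFaceMultihypergraph E) {e : D.Label} (he : e ∈ E) :
    IsZeroBlock (D.val (u := e.1)) e.2 := by
  rcases hE.1 e he with ⟨a, b, hab, h, he⟩ | h
  · exact Or.inl ⟨a, b, fun h => hab (congrArg _ h), h, by simp [he]⟩
  · exact Or.inr ⟨h.1, h.2.2⟩

/-- For a `v`-complete face multihypergraph the faces at a vertex not joined to `v` of the vertices
in a union of components sum to zero. -/
theorem Complete.sum_delta_eq_zero {D : FaceData G R s n} {E : Set D.Label} {v : V}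
    (hE : D.IsFaceMultihypergraph E) (hc : D.Complete E v) {I : Finset (Fin D.m)}
    (hI : ∀ i j, D.Joined E i j → i ∈ I → j ∈ I) {u : V} (hu : u ≠ v) (hadj : ¬ s.Adj G u v) :
    s.delta u (∑ i ∈ I, D.x i) = 0 := by
  classical
  let P : Finset (Finset (D.Slot u)) :=
    Finset.univ.filter fun e => (⟨u, e⟩ : D.Label) ∈ E ∧ ∃ a ∈ e, a.1 ∈ I
  have hP : ∀ e ∈ P, (⟨u, e⟩ : D.Label) ∈ E ∧ ∃ a ∈ e, a.1 ∈ I := fun e he =>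
    (Finset.mem_filter.1 he).2
  -- Since I is closed under joining, a hyperedge meeting I lies entirely over I. By completeness
  -- the summands over I are thus a disjoint union of zero blocks.
  have h1 : I.sigma (fun i => (Finset.univ : Finset (Fin (D.c i u)))) = P.biUnion id := by
    ext a
    rw [Finset.mem_sigma, Finset.mem_biUnion]
    constructor
    · rintro ⟨ha, -⟩
      obtain ⟨e, he, hae⟩ := hc.2 u hu hadj a
      exact ⟨e, Finset.mem_filter.2 ⟨Finset.mem_univ _, he, a, hae, ha⟩, hae⟩
    · rintro ⟨e, he, hae⟩
      obtain ⟨heE, b, hbe, hb⟩ := hP e he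
      exact ⟨hI _ _ ⟨_, heE, ⟨b, hbe, rfl⟩, a, hae, rfl⟩ hb, Finset.mem_univ _⟩
  have h2 : ∀ i ∈ I, s.delta u (D.x i) = ∑ k, D.val (⟨i, k⟩ : D.Slot u) :=
    fun i _ => D.delta_eq i u
  rw [map_sum, Finset.sum_congr rfl h2,
    ← Finset.sum_sigma I (fun i => Finset.univ) fun a => D.val (u := u) a, h1, Finset.sum_biUnion]
  · exact Finset.sum_eq_zero fun e he => (hE.isZeroBlock (hP e he).1).sum_eq_zero
  · intro e he f hf hef
    exact hE.2 u e f (hP e he).1 (hP f hf).1 hef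

/-- Hyperedges are nonempty, so the covered summands determine at which vertices hyperedges occur;
both halves of completeness can be read off them. -/
theorem Complete.of_covered_eq {D : FaceData G R s n} {E E' : Set D.Label} {v : V}
    (hE' : D.IsFaceMultihypergraph E') (h : D.covered E = D.covered E') (hc : D.Complete E v) :
    D.Complete E' v := by
  constructor
  · rintro ⟨u, e⟩ he
    obtain ⟨a, ha⟩ := (hE'.isZeroBlock he).nonempty
    obtain ⟨f, hf, -⟩ := mem_covered.1 (h ▸ mem_covered.2 ⟨e, he, ha⟩)
    exact hc.1 ⟨u, f⟩ hf
  · intro u hu hadj a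
    exact mem_covered.1 (h ▸ mem_covered.2 (hc.2 u hu hadj a))

/-- If the faces at the vertices not joined to `v` cancel, then there is a `v`-complete face
multihypergraph. -/
theorem exists_complete [Nontrivial R] (D : FaceData G R s n) {B : Set (Chain V R)}
    (hB : LinearIndependent R (Subtype.val : B → Chain V R))
    (hpart : ∀ i u k, D.part i u k ∈ B ∨ - D.part i u k ∈ B) {v : V}
    (h0 : ∀ u, u ≠ v → ¬ s.Adj G u v → s.delta u (∑ i, D.x i) = 0) :
    ∃ E, D.IsFaceMultihypergraph E ∧ D.Complete E v := by
  have hP : ∀ u, u ≠ v ∧ ¬ s.Adj G u v → ∃ P : Set (Finset (D.Slot u)),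
      (∀ e ∈ P, IsZeroBlock D.val e) ∧ (∀ e ∈ P, ∀ f ∈ P, e ≠ f → Disjoint e f) ∧
      ∀ a, a ∈ Finset.univ ↔ ∃ e ∈ P, a ∈ e := by
    rintro u ⟨hu, hadj⟩
    refine exists_zeroBlock_partition hB (fun a => hpart a.1 u a.2) _ ?_
    rw [Fintype.sum_sigma, ← h0 u hu hadj, map_sum]
    exact Finset.sum_congr rfl fun i _ => (D.delta_eq i u).symm
  choose P hblock hdisj hcov using hP
  -- A zero block over a single i would be a vanishing subsum in the chosen decomposition of the
  -- face of `D.x i`.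
  have hmixed : ∀ {u} {e : Finset (D.Slot u)} {i}, e.Nonempty → ∑ a ∈ e, D.val a = 0 →
      ∃ a ∈ e, a.1 ≠ i := by
    intro u e i hne hsum
    by_contra! hall
    let slot : Fin (D.c i u) → D.Slot u := fun k => ⟨i, k⟩
    have hinj : Set.InjOn slot (slot ⁻¹' e) := fun k _ l _ h =>
      eq_of_heq (Sigma.mk.inj_iff.1 h).2
    have hmem : ∀ a ∈ e, ∃ k, slot k = a := by
      rintro ⟨j, k⟩ ha
      obtain rfl := hall _ ha
      exact ⟨k, rfl⟩
    refine D.part_sum_ne_zero i u (e.preimage slot hinj) ?_ ?_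
    · obtain ⟨a, ha⟩ := hne
      obtain ⟨k, rfl⟩ := hmem a ha
      exact ⟨k, by simpa using ha⟩
    · rw [← hsum]
      refine Finset.sum_preimage slot e hinj D.val fun a ha hr => ?_
      obtain ⟨k, rfl⟩ := hmem a ha
      exact absurd ⟨k, rfl⟩ hr
  refine ⟨{e | ∃ h, e.2 ∈ P e.1 h}, ⟨?_, ?_⟩, ?_, ?_⟩
  · rintro ⟨u, e⟩ ⟨h, he⟩
    have hsum := (hblock u h e he).sum_eq_zero
    rcases hblock u h e he with ⟨a, b, hab, hval, hmem⟩ | hbig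
    · refine Or.inl ⟨a, b, fun hi => ?_, hval, by ext c; simp [hmem]⟩
      obtain ⟨c, hc, hci⟩ := hmixed (i := a.1) ⟨a, (hmem a).2 (Or.inl rfl)⟩ hsum
      rcases (hmem c).1 hc with rfl | rfl
      exacts [hci rfl, hci hi.symm]
    · obtain ⟨a, ha⟩ := (hblock u h e he).nonempty
      obtain ⟨b, hb, hba⟩ := hmixed (i := a.1) ⟨a, ha⟩ hsum
      exact Or.inr ⟨hbig.1, ⟨b, hb, a, ha, hba⟩, hbig.2⟩
  · rintro u e f ⟨h, he⟩ ⟨_, hf⟩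
    exact hdisj u h e he f hf
  · rintro ⟨u, e⟩ ⟨h, -⟩
    exact h.symm
  · intro u hu hadj a
    obtain ⟨e, he, ha⟩ := (hcov u ⟨hu, hadj⟩ a).1 (Finset.mem_univ a)
    exact ⟨e, ⟨⟨hu, hadj⟩, he⟩, ha⟩

/-- Face data on given vertices, the summands of the faces being signed basis elements. -/
theorem exists_of_basis (hG : ∀ v, ¬ G.Adj v v) (hR : HasSignedMultiples R)
    {B : Set (Chain V R)} (hB : IsBasisOf B (Omega G R (n - 1))) {m : ℕ} (x : Fin m → Chain V R)
    (hx : ∀ i, x i ∈ Omega G R n) (hneg : ∀ i j, i ≠ j → x i ≠ - x j) :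
    ∃ (c : Fin m → V → ℕ) (part : ∀ (i : Fin m) (u : V), Fin (c i u) → Chain V R)
      (h1 : ∀ i u k, part i u k ∈ Omega G R (n - 1)) (h2 : ∀ i u, s.delta u (x i) = ∑ k, part i u k)
      (h3 : ∀ i u (t : Finset (Fin (c i u))), t.Nonempty → ∑ k ∈ t, part i u k ≠ 0),
      ∀ i u k, (mk m x hx hneg c part h1 h2 h3 : FaceData G R s n).part i u k ∈ B ∨
        - (mk m x hx hneg c part h1 h2 h3 : FaceData G R s n).part i u k ∈ B := by
  have h := fun i u => exists_signed_decomposition hR hB.1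
    (hB.2.symm ▸ s.delta_mem_Omega hG u (hx i) : s.delta u (x i) ∈ Submodule.span R B)
  choose c part hmem hsum hne using h
  refine ⟨c, part, fun i u k => ?_, hsum, hne, hmem⟩
  rw [← hB.2]
  rcases hmem i u k with h | h
  · exact Submodule.subset_span h
  · exact neg_mem_iff.1 (Submodule.subset_span h)

end FaceData

/-! ### Generation by inductive elements -/

section Generation

variable {V R : Type*} [CommRing R] {s : Side}

theorem Side.ends_neg (x : Chain V R) : s.ends (-x) = s.ends x := by
  simp [Side.ends]

theorem Side.ends_sum_subset {ι : Type*} (t : Finset ι) (x : ι → Chain V R) :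
    s.ends (∑ i ∈ t, x i) ⊆ ⋃ i ∈ t, s.ends (x i) := by
  classical
  rintro w ⟨l, hl, hw⟩
  obtain ⟨i, hi, hl⟩ := Finset.mem_biUnion.1 (Finsupp.support_finsetSum hl)
  exact Set.mem_biUnion hi ⟨l, hl, hw⟩

theorem Side.ends_mapDomain_add {v : V} {y : Chain V R} (hy : y ≠ 0) :
    s.ends (y.mapDomain (s.add v)) = {v} := by
  classical
  rw [Side.ends, Finsupp.mapDomain_support_of_injective (s.add_injective v)]
  ext w
  simp only [Finset.mem_image, Set.mem_ofPred_eq, Set.mem_singleton_iff]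
  constructor
  · rintro ⟨_, ⟨l, -, rfl⟩, h⟩
    rw [s.endpoint_add] at h
    exact (Option.some_injective _ h).symm
  · rintro rfl
    obtain ⟨l, hl⟩ := Finsupp.support_nonempty_iff.2 hy
    exact ⟨_, ⟨l, hl, rfl⟩, s.endpoint_add _ l⟩

/-- Splitting off components of disconnected mutations writes the extension of a sum of signed
basis elements as a sum of inductive elements. -/
theorem extend_sum_mem_span [Nontrivial R] {G : Digraph V} (hG : ∀ v, ¬ G.Adj v v)
    (hR : HasSignedMultiples R) {n : ℤ} {B₁ B₂ : Set (Chain V R)}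
    (hB₁ : B₁ ⊆ Omega G R (n - 1)) (hB₂ : IsBasisOf B₂ (Omega G R (n - 1 - 1))) {v : V} (m : ℕ)
    (x : Fin m → Chain V R) (hx : ∀ i, x i ∈ B₁ ∨ - x i ∈ B₁) (hneg : ∀ i j, i ≠ j → x i ≠ - x j)
    (hadj : ∀ i, ∀ w ∈ s.ends (x i), s.Adj G w v)
    (hδ : ∀ u, u ≠ v → ¬ s.Adj G u v → s.delta u (∑ i, x i) = 0) :
    s.extend G v (∑ i, x i) ∈ Submodule.span R (inductiveElements G s n B₁ B₂) := by
  classical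
  induction m using Nat.strong_induction_on with
  | _ m ih =>
  have hxO : ∀ i, x i ∈ Omega G R (n - 1) := fun i =>
    (hx i).elim (fun h => hB₁ h) fun h => neg_mem_iff.1 (hB₁ h)
  -- The zero chain has no ends, so it is not inductive and is set aside; this covers m = 0.
  by_cases h0 : ∑ i, x i = 0
  · rw [h0, map_zero]
    exact zero_mem _
  obtain ⟨c, part, h1, h2, h3, hpart⟩ :=
    FaceData.exists_of_basis (s := s) hG hR hB₂ x hxO hneg
  set D : FaceData G R s (n - 1) := ⟨m, x, hxO, hneg, c, part, h1, h2, h3⟩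
  obtain ⟨E, hE, hc⟩ := D.exists_complete hB₂.1 hpart hδ
  by_cases hs : D.StronglyConnected E
  · refine Submodule.subset_span ?_
    have hyO : ∑ i, x i ∈ Omega G R (n - 1) := sum_mem fun i _ => hxO i
    have hyadj : ∀ w ∈ s.ends (∑ i, x i), s.Adj G w v := fun w hw => by
      obtain ⟨i, -, hi⟩ := Set.mem_iUnion₂.1 (Side.ends_sum_subset _ _ hw)
      exact hadj i w hi
    have hext := s.extend_eq_mapDomain hyO.1 hyadj
    refine ⟨?_, v, ?_, D, E, hE, hs, ⟨hadj, rfl⟩, hc, hx, hpart⟩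
    · rw [hext, s.mapDomain_add_mem_Omega hG (fun l hl => ne_nil_of_mem_support hyO hl) hyadj]
      exact ⟨hyO, hδ⟩
    · rw [hext, Side.ends_mapDomain_add h0]
  · simp only [FaceData.StronglyConnected, FaceData.Connected] at hs
    push Not at hs
    obtain ⟨E', hEE', i, j, hij⟩ := hs
    obtain ⟨hface, hcov⟩ := FaceData.eqvGen_mutation hEE'
    have hE' := hface.1 hE
    have hc' := hc.of_covered_eq hE' hcov
    have hsymm : ∀ k l, D.Joined E' k l → D.Joined E' l k := fun k l ⟨e, he, h, h'⟩ =>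
      ⟨e, he, h', h⟩
    -- Only the vanishing of the face sums passes to the smaller family; the induction hypothesis
    -- chooses face decompositions and hyperedges afresh.
    have key : ∀ I : Finset (Fin m), I ≠ Finset.univ →
        (∀ k l, D.Joined E' k l → k ∈ I → l ∈ I) →
        s.extend G v (∑ k ∈ I, x k) ∈ Submodule.span R (inductiveElements G s n B₁ B₂) := by
      intro I hI hclosed
      have hcard : I.card < m := by
        simpa using Finset.card_lt_card (Finset.ssubset_univ_iff.2 hI)
      have hsum : ∑ k, x (I.equivFin.symm k) = ∑ k ∈ I, x k := by
        rw [Equiv.sum_comp I.equivFin.symm fun k : I => x k, Finset.sum_coe_sort I x]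
      rw [← hsum]
      refine ih _ hcard (fun k => x (I.equivFin.symm k)) (fun k => hx _)
        (fun k l hkl => hneg _ _ fun h => hkl ?_) (fun k => hadj _) fun u hu huv => ?_
      · exact I.equivFin.symm.injective (Subtype.ext h)
      · rw [hsum]
        exact hc'.sum_delta_eq_zero hE' hclosed hu huv
    -- The component of i misses j and its complement misses i, so both are proper, and both are
    -- closed under joining.
    let I : Finset (Fin m) := Finset.univ.filter fun k => Relation.ReflTransGen (D.Joined E') i k
    have hmem : ∀ k, k ∈ I ↔ Relation.ReflTransGen (D.Joined E') i k := by simp [I]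
    rw [← Finset.sum_add_sum_compl I x, map_add]
    refine add_mem (key I (fun h => hij ?_) fun k l hkl hk => ?_)
      (key Iᶜ (fun h => ?_) fun k l hkl hk => ?_)
    · exact (hmem j).1 (h ▸ Finset.mem_univ j)
    · exact (hmem l).2 (((hmem k).1 hk).tail hkl)
    · have : i ∉ I := Finset.mem_compl.1 (h ▸ Finset.mem_univ i)
      exact this ((hmem i).2 .refl)
    · rw [Finset.mem_compl] at hk ⊢
      exact fun hl => hk ((hmem k).2 (((hmem l).1 hl).tail (hsymm _ _ hkl)))

theorem span_inductiveElements [Nontrivial R] {G : Digraph V} (hG : ∀ v, ¬ G.Adj v v)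
    (hR : HasSignedMultiples R) {n : ℤ} (hn : 1 ≤ n) {B₁ B₂ : Set (Chain V R)}
    (hB₁ : IsBigradedBasis G (n - 1) B₁) (hB₂ : IsBigradedBasis G (n - 2) B₂) :
    Submodule.span R (inductiveElements G s n B₁ B₂) = Omega G R n := by
  refine le_antisymm (Submodule.span_le.2 fun y hy => hy.1) fun x hx => ?_
  refine s.Omega_induction hG hn LinearMap.id _ (fun v y hy hadj hδ => ?_) hx
  have hB₁' : LinearIndependent R
      (Subtype.val : {b ∈ B₁ | ∀ w ∈ s.ends b, s.Adj G w v} → Chain V R) :=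
    LinearIndepOn.mono (v := id) hB₁.1.1 fun b hb => hb.1
  obtain ⟨m, z, hz, rfl, hne⟩ :=
    exists_signed_decomposition hR hB₁' (s.mem_span_adj hG hB₁ hy hadj)
  rw [LinearMap.id_apply, ← s.extend_eq_mapDomain hy.1 hadj]
  refine extend_sum_mem_span hG hR ?_ ?_ m z ?_ ?_ ?_ hδ
  · exact hB₁.1.2 ▸ Submodule.subset_span
  · rw [show n - 1 - 1 = n - 2 by ring]
    exact hB₂.1
  · exact fun i => (hz i).imp (fun h => h.1) fun h => h.1
  · intro i j hij h
    -- An opposite pair would be a vanishing subsum.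
    refine hne {i, j} (Finset.insert_nonempty _ _) ?_
    rw [Finset.sum_pair hij, h, neg_add_cancel]
  · intro i w hw
    rcases hz i with h | h
    · exact h.2 w hw
    · exact h.2 w (by rwa [Side.ends_neg])

end Generation

/-! ### Passage to fields of characteristic zero -/

section FieldCoefficients

variable {V : Type*}

open Classical in
theorem gapSum_eq_sum {R : Type*} [CommRing R] (p : List V) (a b : V) (q : List V) {x : Chain V R}
    {T : Finset (List V)} (hT : x.support ⊆ T) :
    gapSum R p a b q x = ∑ l ∈ T.filter (fun l => ∃ u, l = p ++ a :: u :: b :: q), x l := by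
  rw [gapSum, Finsupp.linearCombination_apply, Finsupp.sum_of_support_subset _ hT _ (by simp),
    Finset.sum_filter]
  simp

/-- In characteristic zero `Ω_n(G;K)` is spanned by the image of `Ω_n(G;ℤ)`. -/
theorem mem_span_castChain {K : Type*} [Field K] [CharZero K] {G : Digraph V}
    (hG : ∀ v, ¬ G.Adj v v) {n : ℤ} {x : Chain V K} (hx : x ∈ Omega G K n) :
    x ∈ Submodule.span K (castChain K V '' Omega G ℤ n) := by
  classical
  -- The coefficients of x generate a finitely generated torsion-free, hence free, abelian group.
  -- Taking coordinates there turns x into finitely many integral chains satisfying the same gap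
  -- equations.
  let A : Submodule ℤ K := Submodule.span ℤ (Set.range x)
  have hfin : Module.Finite ℤ A := Module.Finite.span_of_finite ℤ x.finite_range
  let β := Module.Free.chooseBasis ℤ A
  let y : List V → A := fun l => ⟨x l, Submodule.subset_span ⟨l, rfl⟩⟩
  have hy : ∀ l, x l = 0 → y l = 0 := fun l hl => Subtype.ext hl
  let z : Module.Free.ChooseBasisIndex ℤ A → Chain V ℤ := fun i =>
    Finsupp.onFinset x.support (fun l => β.repr (y l) i) fun l hl =>
      Finsupp.mem_support_iff.2 fun h => hl (by simp [hy l h])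
  have hz : ∀ i l, z i l = β.repr (y l) i := fun i l => rfl
  have hsupp : ∀ i, (z i).support ⊆ x.support := fun i => Finsupp.support_onFinset_subset
  rw [mem_Omega_iff hG] at hx
  have hzO : ∀ i, z i ∈ Omega G ℤ n := by
    intro i
    rw [mem_Omega_iff hG]
    refine ⟨fun l hl => hx.1 (hsupp i hl), fun p a b q hne hab => ?_⟩
    have h1 := hx.2 p a b q hne hab
    rw [gapSum_eq_sum p a b q (hsupp i)]
    rw [gapSum_eq_sum p a b q subset_rfl] at h1
    have h2 : ∑ l ∈ x.support.filter (fun l => ∃ u, l = p ++ a :: u :: b :: q), y l = 0 :=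
      Subtype.ext (by simpa [y] using h1)
    simp only [hz]
    rw [← Finsupp.finsetSum_apply, ← map_sum, h2, map_zero, Finsupp.zero_apply]
  have hsum : x = ∑ i, (β i : K) • castChain K V (z i) := by
    ext l
    have h1 := congrArg (Subtype.val : A → K) (β.sum_repr (y l))
    simp only [Submodule.coe_sum, Submodule.coe_smul, zsmul_eq_mul] at h1
    rw [Finsupp.finsetSum_apply]
    refine h1.symm.trans (Finset.sum_congr rfl fun i _ => ?_)
    simp [castChain, hz, mul_comm]
  rw [hsum]
  exact sum_mem fun i _ => Submodule.smul_mem _ _ (Submodule.subset_span ⟨_, hzO i, rfl⟩)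

theorem mu_one_tmul (K : Type*) [Field K] (G : Digraph V) (n : ℤ) (x : Omega G ℤ n) :
    (mu K G n (1 ⊗ₜ[ℤ] x) : Chain V K) = castChain K V x := by
  simp [mu]

/-- Integral chains that generate `Ω_n(G;ℤ)` have images that generate `Ω_n(G;K)`. -/
theorem span_mu_image {K : Type*} [Field K] [CharZero K] {G : Digraph V}
    (hG : ∀ v, ¬ G.Adj v v) {n : ℤ} {I : Set (Chain V ℤ)} (hI : Submodule.span ℤ I = Omega G ℤ n) :
    Submodule.span K ((fun x : Omega G ℤ n => mu K G n (1 ⊗ₜ[ℤ] x)) '' {x | (x : Chain V ℤ) ∈ I}) =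
      ⊤ := by
  refine Submodule.map_injective_of_injective (Omega G K n).injective_subtype ?_
  rw [Submodule.map_span, Submodule.map_top, Submodule.range_subtype, Set.image_image]
  have himage : (fun x : Omega G ℤ n => (Omega G K n).subtype (mu K G n (1 ⊗ₜ[ℤ] x))) ''
      {x | (x : Chain V ℤ) ∈ I} = castChain K V '' I := by
    ext z
    constructor
    · rintro ⟨x, hx, rfl⟩
      exact ⟨x, hx, (mu_one_tmul K G n x).symm⟩
    · rintro ⟨x, hx, rfl⟩
      exact ⟨⟨x, hI ▸ Submodule.subset_span hx⟩, hx, mu_one_tmul K G n _⟩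
  rw [himage]
  apply le_antisymm
  · rw [Submodule.span_le]
    rintro _ ⟨x, hx, rfl⟩
    exact castChain_mem_Omega K G n (hI ▸ Submodule.subset_span hx)
  · refine fun x hx => Submodule.span_le.2 ?_ (mem_span_castChain hG hx)
    rintro _ ⟨y, hy, rfl⟩
    rw [← hI] at hy
    have h := Submodule.mem_map_of_mem (f := castChain K V) hy
    rw [Submodule.map_span] at h
    exact Submodule.span_le_restrictScalars ℤ K _ h

theorem exists_isBasisOf_subset {K N : Type*} [Field K] [AddCommGroup N] [Module K N] (S : Set N) :
    ∃ T ⊆ S, IsBasisOf T (Submodule.span K S) := by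
  obtain ⟨T, hT, hspan, hli⟩ := exists_linearIndependent K S
  exact ⟨T, hT, hli, hspan⟩

end FieldCoefficients

end PathHomology

end

theorem mainTheorem4 {V : Type*} (G : Digraph V) (hG : ∀ v : V, ¬ G.Adj v v)
    (n : ℤ) (hn : 1 ≤ n) (s : Side) :
    (∀ B₁ B₂ : Set (Chain V ℤ),
      IsBigradedBasis G (n - 1) B₁ → IsBigradedBasis G (n - 2) B₂ →
        Submodule.span ℤ (inductiveElements G s n B₁ B₂) = Omega G ℤ n ∧
        ∀ (K : Type*) [Field K] [CharZero K],
          ∃ T : Set (Omega G K n),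
            T ⊆ (fun x : Omega G ℤ n => mu K G n (1 ⊗ₜ[ℤ] x)) ''
              {x | (x : Chain V ℤ) ∈ inductiveElements G s n B₁ B₂} ∧
            IsBasisOf T (⊤ : Submodule K (Omega G K n))) ∧
    (∀ (p : ℕ) [Fact p.Prime] (B₁ B₂ : Set (Chain V (ZMod p))),
      IsBigradedBasis G (n - 1) B₁ → IsBigradedBasis G (n - 2) B₂ →
        Submodule.span (ZMod p) (inductiveElements G s n B₁ B₂) = Omega G (ZMod p) n ∧
        ∃ T ⊆ inductiveElements G s n B₁ B₂, IsBasisOf T (Omega G (ZMod p) n)) := by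
  refine ⟨fun B₁ B₂ hB₁ hB₂ => ?_, fun p _ B₁ B₂ hB₁ hB₂ => ?_⟩
  · have h := span_inductiveElements (s := s) hG hasSignedMultiples_int hn hB₁ hB₂
    refine ⟨h, fun K _ _ => ?_⟩
    obtain ⟨T, hT, hbasis⟩ := exists_isBasisOf_subset (K := K)
      ((fun x : Omega G ℤ n => mu K G n (1 ⊗ₜ[ℤ] x)) ''
        {x | (x : Chain V ℤ) ∈ inductiveElements G s n B₁ B₂})
    rw [span_mu_image hG h] at hbasis
    exact ⟨T, hT, hbasis⟩
  · have h := span_inductiveElements (s := s) hG (hasSignedMultiples_zmod p) hn hB₁ hB₂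
    refine ⟨h, ?_⟩
    obtain ⟨T, hT, hbasis⟩ := exists_isBasisOf_subset (K := ZMod p)
      (inductiveElements G s n B₁ B₂)
    rw [h] at hbasis
    exact ⟨T, hT, hbasis⟩
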